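/- **Setting.** Let $J\ge 2$ and $d$ be integers, and let $L_1,\dots,L_J$ be meromorphic functions on $\mathbb C$ satisfying the following assumptions, where $\alpha_{j,i}(p)\in\mathbb C$ ($1\le j\le J$, $1\le i\le d$, $p$ prime). * **A1 (Euler product).** $L_j(s)=\prod_p\prod_{i=1}^d\bigl(1-\alpha_{j,i}(p)p^{-s}\bigr)^{-1}$ for $\mathrm{Re}(s)>1$, and $|\alpha_{j,i}(p)|\le p^{\theta}$ for some fixed $0\le\theta<1/2$. * **A2 (functional equation).** There are $\omega\in\mathbb C$ with $|\omega|=1$, $Q>0$, $\lambda_\ell>0$ and $\mu_\ell\in\mathbb C$ with $\mathrm{Re}(\mu_\ell)\ge 0$ $(1\le\ell\le m)$, the same for all $j$, such that $\Lambda_j(s):=L_j(s)Q^s\prod_{\ell=1}^m\Gamma(\lambda_\ell s+\mu_\ell)$ satisfies $\Lambda_j(s)=\omega\,\overline{\Lambda_j(1-\bar s)}$ (as meromorphic functions). * **A3 (Ramanujan hypothesis on average).** $\sum_{p\le x}\sum_{i=1}^d|\alpha_{j,i}(p)|^2=O_\varepsilon(x^{1+\varepsilon})$ as $x\to\infty$,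 for all $j$ and all $\varepsilon>0$. * **A4 (zero density).** Let $N_{L_j}(\sigma,T)$ be the number of zeros of $L_j$, counted with multiplicity, in $\mathrm{Re}(s)\ge\sigma$, $T\le\mathrm{Im}(s)\le 2T$. There are constants $c_1,c_2>0$ such that $N_{L_j}(\sigma,T)\ll T^{1-c_1(\sigma-1/2)}(\log T)^{c_2}$ for all $j$, uniformly in $\sigma\ge 1/2$ and $T$ large. * **A5 (Selberg orthonormality).** Let $\beta_{L_j}(p)=\sum_{i=1}^d\alpha_{j,i}(p)$, the coefficient of $p^{-s}$ in $\log L_j(s)$. There are constants $\xi_j>0$ and $c_{j,k}\in\mathbb C$ such that, for all $1\le j,k\le J$, as $x\to\infty$, $$\sum_{p\le x}\frac{\beta_{L_j}(p)\overline{\beta_{L_k}(p)}}{p}=\delta_{j,k}\,\xi_j\log\log x+c_{j,k}+O\Bigl(\frac1{\log x}\Bigr).$$ Let $b_1,\dots,b_J$ be nonzero real numbers with $\sum_{j\le J}b_j^2=1$. Let $\{\mathbb X(p)\}_p$ be independent random variables indexed by the primes, each uniformly distributed on the unit circle. For $\sigma>1/2$ put $$L_j(\sigma,\mathbb X)=\prod_p\prod_{i=1}^d\Bigl(1-\frac{\alpha_{j,i}(p)\,\mathbb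 X(p)}{p^\sigma}\Bigr)^{-1},\qquad F(\sigma,\mathbb X)=\sum_{j=1}^J b_jL_j(\sigma,\mathbb X),$$ the product being taken over the primes in increasing order. **Proposition 2.5.** There exist constants $C_3>0$, $A>0$ and $T_0$, depending only on the $L_j$ (with their local parameters) and the $b_j$, such that for every $T\ge T_0$, every real $G$ with $2<G\le\log T$, $\sigma=\frac12+\frac1{G}$, the following holds. Almost surely all the products $L_j(\sigma,\mathbb X)$ converge to nonzero limits and $F(\sigma,\mathbb X)\ne 0$. For every integer $k\ge 1$ the random variable $\bigl|\log|F(\sigma,\mathbb X)|\bigr|^{2k}$ is integrable, and $$\mathbb E\Bigl[\bigl|\log|F(\sigma,\mathbb X)|\bigr|^{2k}\Bigr]\le A\,(\log\log T)^{J}\bigl(C_3\,k\,(k+\log\log T)\bigr)^{k}.$$ -/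

import Mathlib

open Filter Topology MeasureTheory ProbabilityTheory
open scoped ENNReal ComplexConjugate

noncomputable section

/-- The primes `p ≤ N`. -/
def primesUpTo (N : ℕ) : Finset Nat.Primes :=
  (Finset.range (N + 1)).subtype Nat.Prime

theorem mem_primesUpTo {N : ℕ} {p : Nat.Primes} : p ∈ primesUpTo N ↔ (p : ℕ) ≤ N :=
  Finset.mem_subtype.trans (Finset.mem_range.trans Nat.lt_succ_iff)

/-- The coefficient `β_{L_j}(p^k) = (1/k) ∑_{i ≤ d} α_{j,i}(p)^k` of `p^{-ks}` in
`log L_j(s) = -∑_p ∑_{i ≤ d} log (1 - α_{j,i}(p) p^{-s})`. -/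
def eulerLogCoeff {J d : ℕ} (α : Fin J → Fin d → Nat.Primes → ℂ) (j : Fin J)
    (p : Nat.Primes) (k : ℕ) : ℂ :=
  (∑ i, α j i p ^ k) / k

/-- `N_f(σ, T)`: the number of zeros, with multiplicity, of the meromorphic function `f` in
`Re s ≥ σ`, `T ≤ Im s ≤ 2T` (poles contribute nothing). -/
def zeroCount (f : ℂ → ℂ) (σ T : ℝ) : ℝ≥0∞ :=
  ∑' s : {s : ℂ | σ ≤ s.re ∧ T ≤ s.im ∧ s.im ≤ 2 * T},
    (((meromorphicOrderAt f s).untop₀.toNat : ℕ) : ℝ≥0∞)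

/-- The completed function `Λ(s) = f(s) Q^s ∏_ℓ Γ(λ_ℓ s + μ_ℓ)`. -/
def completedL {m : ℕ} (Q : ℝ) (lam : Fin m → ℝ) (mu : Fin m → ℂ) (f : ℂ → ℂ) (s : ℂ) : ℂ :=
  f s * (Q : ℂ) ^ s * ∏ l, Complex.Gamma ((lam l : ℂ) * s + mu l)

/-- The family `L_1, …, L_J` of meromorphic functions, with local parameters `α_{j,i}(p)`,
satisfies the assumptions A1--A5. -/
structure IsLFamily {J d : ℕ} (L : Fin J → ℂ → ℂ)
    (α : Fin J → Fin d → Nat.Primes → ℂ) : Prop where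
  meromorphic : ∀ j, MeromorphicOn (L j) Set.univ
  /-- A1, size of the local parameters -/
  param_bound : ∃ θ : ℝ, 0 ≤ θ ∧ θ < 1 / 2 ∧ ∀ j i (p : Nat.Primes), ‖α j i p‖ ≤ (p : ℝ) ^ θ
  /-- A1, Euler product -/
  euler_product : ∀ j (s : ℂ), 1 < s.re →
    HasProd (fun p : Nat.Primes => ∏ i, (1 - α j i p / (p : ℂ) ^ s)⁻¹) (L j s)
  /-- A2, a common functional equation (an identity of meromorphic functions, so it is required
  outside a discrete closed set) -/
  functional_equation : ∃ (ω : ℂ) (Q : ℝ) (m : ℕ) (lam : Fin m → ℝ) (mu : Fin m → ℂ),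
    ‖ω‖ = 1 ∧ 0 < Q ∧ (∀ l, 0 < lam l) ∧ (∀ l, 0 ≤ (mu l).re) ∧
    ∀ j, (fun s => completedL Q lam mu (L j) s) =ᶠ[codiscrete ℂ]
      fun s => ω * conj (completedL Q lam mu (L j) (1 - conj s))
  /-- A3, Ramanujan hypothesis on average -/
  ramanujan_average : ∀ j, ∀ ε : ℝ, 0 < ε →
    (fun x : ℝ => ∑ p ∈ primesUpTo ⌊x⌋₊, ∑ i, ‖α j i p‖ ^ 2) =O[atTop]
      fun x : ℝ => x ^ (1 + ε)
  /-- A4, zero density hypothesis, uniformly in `σ ≥ 1/2` -/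
  zero_density : ∃ c₁ c₂ C T₀ : ℝ, 0 < c₁ ∧ 0 < c₂ ∧
    ∀ j, ∀ σ T : ℝ, 1 / 2 ≤ σ → T₀ ≤ T →
      zeroCount (L j) σ T ≤
        ENNReal.ofReal (C * T ^ (1 - c₁ * (σ - 1 / 2)) * Real.log T ^ c₂)
  /-- A5, Selberg orthonormality -/
  orthonormality : ∃ (ξ : Fin J → ℝ) (c : Fin J → Fin J → ℂ), (∀ j, 0 < ξ j) ∧
    ∀ j k,
      (fun x : ℝ =>
        ∑ p ∈ primesUpTo ⌊x⌋₊, eulerLogCoeff α j p 1 * conj (eulerLogCoeff α k p 1) / (p : ℂ)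
          - ((if j = k then ξ j * Real.log (Real.log x) else 0 : ℝ) : ℂ) - c j k) =O[atTop]
      fun x : ℝ => 1 / Real.log x

/-- The uniform probability measure on the unit circle of `ℂ`: the law of `e^{it}` for `t`
uniformly distributed in `(0, 2π]`. -/
def uniformUnitCircle : Measure ℂ :=
  (ProbabilityTheory.cond volume (Set.Ioc (0 : ℝ) (2 * Real.pi))).map
    fun t : ℝ => Complex.exp (t * Complex.I)

/-- The partial product over `p ≤ N` of the random Euler product `L_j(σ, X)`, at a sample point
`x = (x(p))_p`. -/
def randomLPartial {J d : ℕ} (α : Fin J → Fin d → Nat.Primes → ℂ) (σ : ℝ)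
    (x : Nat.Primes → ℂ) (j : Fin J) (N : ℕ) : ℂ :=
  ∏ p ∈ primesUpTo N, ∏ i, (1 - α j i p * x p / (((p : ℝ) ^ σ : ℝ) : ℂ))⁻¹

/-- `L_j(σ, x)`: the Euler product over all primes, taken in increasing order (it converges only
conditionally for `σ` near `1/2`). -/
def randomL {J d : ℕ} (α : Fin J → Fin d → Nat.Primes → ℂ) (σ : ℝ)
    (x : Nat.Primes → ℂ) (j : Fin J) : ℂ :=
  limUnder atTop (randomLPartial α σ x j)

/-- `F(σ, x) = ∑_j b_j L_j(σ, x)`. -/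
def randomF {J d : ℕ} (b : Fin J → ℝ) (α : Fin J → Fin d → Nat.Primes → ℂ) (σ : ℝ)
    (x : Nat.Primes → ℂ) : ℂ :=
  ∑ j, (b j : ℂ) * randomL α σ x j

end

/-!
The logarithms `Z_j(p) = -∑_i log (1 - α_{j,i}(p) X(p) p^{-σ})` of the Euler factors are
independent over `p`, centred (mean value property), bounded by a constant `M`, and have total
variance `V ≪ log log T`: the square of the linear term `β_j(p) X(p) p^{-σ}` is summed by
orthonormality, and the square of the remainder, which is of fourth order in the local parameters,
by the Ramanujan hypothesis on average and `θ < 1/2`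
(`IsLFamily.exists_sum_logEulerFactorVar_le`). Hence the partial sums of `∑_p Z_j(p)` are
martingales bounded in `L¹`, so the products converge almost surely to nonzero limits, and for
`|t| M ≤ 1` the partial products satisfy `E |L_j| ^ t ≤ exp (t² V)`, uniformly in the truncation.

The difficulty is to show that `F` is rarely small. Fix an index `j₀`. By orthonormality there are
distinct primes `p_m`, `m ≠ j₀`, with `β_m(p_m) ≠ β_{j₀}(p_m)`. As a function of `z = X(p_m)` alone,
`F / L_{j₀}` is a linear combination `∑_j a_j E_j(z) / E_{j₀}(z)` of quotients of Euler factors,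
that is, a polynomial of bounded degree up to a bounded factor. A polynomial `Q` of degree at most
`n` satisfies `∫ |Q| ^ (-δ) ≪ M(Q) ^ (-δ)` on the unit circle when `n δ ≤ 1/2`, where `M(Q)` is the
Mahler measure (factor `Q` and reduce to the singular integral of `|z - ρ| ^ (-1/2)`), and `M(Q)`
dominates the two lowest coefficients of `Q`, hence also the functional
`∑_j a_j (β_j(p_m) - β_m(p_m)) p_m^{-σ}`, which no longer contains the `m`-th term. Integrating out
the `X(p_m)` one after another eliminates all terms except the one of index `j₀`, which is a nonzero
constant. Therefore `E |F / L_{j₀}| ^ (-δ)` is bounded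
(`IsLFamily.exists_lintegral_randomLPartial_ratio_rpow_neg_le`).

Together this gives `E (|F| ^ t + |F| ^ (-t)) ≪ exp (4 t² V)` for small `t`, first for the truncated
products and then, by Fatou's lemma, for `F` itself (`IsLFamily.exists_lintegral_randomF_rpow_le`).
In particular `F ≠ 0` almost surely, and `y ^ (2k) ≤ (2k)! t ^ (-2k) exp (t y)` with
`t² ≍ k / (k + log log T)` bounds the moments of `|log |F||` by a constant times
`(C k (k + log log T)) ^ k`. The factor `(log log T) ^ J ≥ 1` only weakens the bound.
-/

noncomputable section

/-! ### A singular integral on the unit circle -/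

theorem ennreal_rpow_neg_le_rpow_neg {x y : ℝ≥0∞} {δ : ℝ} (hδ : 0 ≤ δ) (h : x ≤ y) :
    y ^ (-δ) ≤ x ^ (-δ) := by
  rw [ENNReal.rpow_neg, ENNReal.rpow_neg]
  exact ENNReal.inv_le_inv.2 (ENNReal.rpow_le_rpow h hδ)

instance : IsProbabilityMeasure uniformUnitCircle := by
  have hv : volume (Set.Ioc (0 : ℝ) (2 * Real.pi)) ≠ 0 := by
    simp [Real.volume_Ioc, Real.pi_pos]
  have hv' : volume (Set.Ioc (0 : ℝ) (2 * Real.pi)) ≠ ∞ := by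
    rw [Real.volume_Ioc]; exact ENNReal.ofReal_ne_top
  have := cond_isProbabilityMeasure_of_finite hv hv'
  exact Measure.isProbabilityMeasure_map (by fun_prop)

theorem lintegral_uniformUnitCircle {f : ℂ → ℝ≥0∞} (hf : Measurable f) :
    ∫⁻ z, f z ∂uniformUnitCircle =
      (ENNReal.ofReal (2 * Real.pi))⁻¹ *
        ∫⁻ t in Set.Ioc (0 : ℝ) (2 * Real.pi), f (Complex.exp (t * Complex.I)) := by
  rw [uniformUnitCircle, lintegral_map hf (by fun_prop), ProbabilityTheory.cond,
    lintegral_smul_measure, Real.volume_Ioc, sub_zero, smul_eq_mul]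

theorem integral_uniformUnitCircle {f : ℂ → ℂ} (hf : Measurable f) :
    ∫ z, f z ∂uniformUnitCircle = Real.circleAverage f 0 1 := by
  rw [uniformUnitCircle, integral_map (by fun_prop) hf.aestronglyMeasurable,
    ProbabilityTheory.cond, integral_smul_measure, Real.volume_Ioc, Real.circleAverage_def,
    intervalIntegral.integral_of_le Real.two_pi_pos.le, sub_zero]
  congr 1
  · rw [ENNReal.toReal_inv, ENNReal.toReal_ofReal Real.two_pi_pos.le]
  · simp [circleMap]

theorem ae_norm_eq_one_uniformUnitCircle : ∀ᵐ z ∂uniformUnitCircle, ‖z‖ = 1 := by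
  rw [uniformUnitCircle, ae_map_iff (by fun_prop) (measurableSet_eq_fun (by fun_prop) (by fun_prop))]
  exact Eventually.of_forall fun t => Complex.norm_exp_ofReal_mul_I t

/-- A point of the unit circle is at least as far from `ρ`, on the scale `max 1 ‖ρ‖`, as from the
direction `exp (i arg ρ)`, up to constants; the bound is in terms of the angle. -/
theorem abs_sub_arg_div_le_norm_exp_sub_div (ρ : ℂ) {t : ℝ} (ht : |t - ρ.arg| ≤ Real.pi) :
    |t - ρ.arg| / (2 * Real.pi) ≤ ‖Complex.exp (t * Complex.I) - ρ‖ / max 1 ‖ρ‖ := by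
  set e := Complex.exp (t * Complex.I) with he
  set u := Complex.exp (ρ.arg * Complex.I) with hu
  have hen : ‖e‖ = 1 := Complex.norm_exp_ofReal_mul_I t
  have hun : ‖u‖ = 1 := Complex.norm_exp_ofReal_mul_I _
  have hρ : ρ = ‖ρ‖ * u := (Complex.norm_mul_exp_arg_mul_I ρ).symm
  have hρu : ‖ρ - u‖ = |‖ρ‖ - 1| := by
    have : ρ - u = ((‖ρ‖ - 1 : ℝ) : ℂ) * u := by
      conv_lhs => rw [hρ]
      push_cast; ring
    rw [this, norm_mul, hun, mul_one, Complex.norm_real, Real.norm_eq_abs]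
  have h1 : |‖ρ‖ - 1| ≤ ‖e - ρ‖ := by
    rw [← hen, abs_sub_comm]; exact abs_norm_sub_norm_le e ρ
  have h2 : ‖e - u‖ ≤ 2 * ‖e - ρ‖ := by
    calc ‖e - u‖ = ‖(e - ρ) + (ρ - u)‖ := by ring_nf
      _ ≤ ‖e - ρ‖ + ‖ρ - u‖ := norm_add_le _ _
      _ ≤ 2 * ‖e - ρ‖ := by rw [hρu]; linarith
  have h3 : ‖e - u‖ ≤ 2 := by
    calc ‖e - u‖ ≤ ‖e‖ + ‖u‖ := norm_sub_le _ _
      _ = 2 := by rw [hen, hun]; norm_num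
  have h4 : ‖e - u‖ = 2 * |Real.sin ((t - ρ.arg) / 2)| := by
    have : e - u = u * (Complex.exp (Complex.I * ((t - ρ.arg : ℝ) : ℂ)) - 1) := by
      rw [mul_sub, hu, ← Complex.exp_add, he, mul_one]
      congr 2; push_cast; ring
    rw [this, norm_mul, hun, one_mul, Complex.norm_exp_I_mul_ofReal_sub_one, Real.norm_eq_abs,
      abs_mul, abs_two]
  have h5 : 2 / Real.pi * |(t - ρ.arg) / 2| ≤ |Real.sin ((t - ρ.arg) / 2)| :=
    Real.mul_abs_le_abs_sin (by rw [abs_div, abs_two]; linarith)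
  have h6 : |t - ρ.arg| / (2 * Real.pi) ≤ ‖e - u‖ / 4 := by
    rw [h4]
    have : |t - ρ.arg| / (2 * Real.pi) = (2 / Real.pi * |(t - ρ.arg) / 2|) / 2 := by
      rw [abs_div, abs_two]; field_simp
    rw [this]; linarith
  refine h6.trans ?_
  rw [le_div_iff₀ (lt_of_lt_of_le one_pos (le_max_left _ _))]
  rcases le_or_gt ‖ρ‖ 2 with h | h
  · have : max 1 ‖ρ‖ ≤ 2 := max_le (by norm_num) h
    nlinarith [norm_nonneg (e - u)]
  · rw [max_eq_right (by linarith)]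
    have : ‖ρ‖ - 1 ≤ ‖e - ρ‖ := (le_abs_self _).trans h1
    nlinarith [norm_nonneg (e - u), norm_nonneg ρ]

theorem lintegral_abs_rpow_neg_half_ne_top :
    ∫⁻ t in Set.Ioc (-Real.pi) Real.pi, ENNReal.ofReal (|t| / (2 * Real.pi)) ^ (-(1 / 2) : ℝ)
      ≠ ∞ := by
  have h0 : IntervalIntegrable (fun t : ℝ => |t| ^ (-(1 / 2) : ℝ)) volume 0 Real.pi := by
    refine (intervalIntegral.intervalIntegrable_rpow' (r := -(1 / 2)) (by norm_num)).congr ?_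
    rw [Set.uIoc_of_le Real.pi_pos.le]
    intro t ht
    simp only [abs_of_pos ht.1]
  have h1 : IntervalIntegrable (fun t : ℝ => |t| ^ (-(1 / 2) : ℝ)) volume (-Real.pi) 0 := by
    have := (IntervalIntegrable.iff_comp_neg (by simp)).1 h0
    simpa using this.symm
  have h2 := h1.trans h0
  rw [intervalIntegrable_iff_integrableOn_Ioc_of_le (by linarith [Real.pi_pos])] at h2
  have h3 := (h2.const_mul ((2 * Real.pi) ^ (1 / 2 : ℝ))).lintegral_lt_top.ne
  refine ne_top_of_le_ne_top h3 (lintegral_mono_ae ?_)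
  have : ∀ᵐ t ∂(volume.restrict (Set.Ioc (-Real.pi) Real.pi)), t ≠ (0 : ℝ) :=
    ae_restrict_of_ae (Measure.ae_ne volume 0)
  filter_upwards [this] with t ht
  have hp : 0 < |t| := abs_pos.2 ht
  rw [ENNReal.ofReal_rpow_of_pos (by positivity)]
  refine ENNReal.ofReal_le_ofReal (le_of_eq ?_)
  rw [Real.div_rpow (abs_nonneg _) (by positivity), Real.rpow_neg (by positivity : (0:ℝ) ≤ 2 * Real.pi),
    div_inv_eq_mul, mul_comm]

/-- The singular integral behind all the negative moments: `‖z - ρ‖ / max 1 ‖ρ‖` has a finite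
moment of order `-1/2` on the unit circle, uniformly in `ρ`. -/
theorem exists_lintegral_norm_sub_div_le :
    ∃ C : ℝ≥0∞, C ≠ ∞ ∧ ∀ ρ : ℂ,
      ∫⁻ z, ENNReal.ofReal (‖z - ρ‖ / max 1 ‖ρ‖) ^ (-(1 / 2) : ℝ) ∂uniformUnitCircle ≤ C := by
  refine ⟨(ENNReal.ofReal (2 * Real.pi))⁻¹ * _,
    ENNReal.mul_ne_top (by simp [Real.pi_pos]) lintegral_abs_rpow_neg_half_ne_top, fun ρ => ?_⟩
  rw [lintegral_uniformUnitCircle (by fun_prop)]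
  refine mul_le_mul' le_rfl ?_
  set f : ℝ → ℝ≥0∞ := fun t =>
    ENNReal.ofReal (‖Complex.exp (t * Complex.I) - ρ‖ / max 1 ‖ρ‖) ^ (-(1 / 2) : ℝ) with hf
  have hper : ∀ (g : AddSubgroup.zmultiples (2 * Real.pi)) (t : ℝ), f (g +ᵥ t) = f t := by
    rintro ⟨_, n, rfl⟩ t
    have : Complex.exp (((n • (2 * Real.pi) + t : ℝ) : ℂ) * Complex.I)
        = Complex.exp (t * Complex.I) := by
      rw [Complex.exp_eq_exp_iff_exists_int]
      exact ⟨n, by push_cast; simp; ring⟩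
    simp only [hf, AddSubgroup.vadd_def, vadd_eq_add, this]
  have hshift : ∫⁻ t in Set.Ioc 0 (2 * Real.pi), f t
      = ∫⁻ t in Set.Ioc (ρ.arg - Real.pi) (ρ.arg - Real.pi + 2 * Real.pi), f t := by
    have h0 := isAddFundamentalDomain_Ioc Real.two_pi_pos 0
    rw [zero_add] at h0
    exact h0.setLIntegral_eq (isAddFundamentalDomain_Ioc Real.two_pi_pos _) f hper
  have htrans : ∫⁻ t in Set.Ioc (ρ.arg - Real.pi) (ρ.arg - Real.pi + 2 * Real.pi),
      ENNReal.ofReal (|t - ρ.arg| / (2 * Real.pi)) ^ (-(1 / 2) : ℝ)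
      = ∫⁻ t in Set.Ioc (-Real.pi) Real.pi,
        ENNReal.ofReal (|t| / (2 * Real.pi)) ^ (-(1 / 2) : ℝ) := by
    rw [show ρ.arg - Real.pi + 2 * Real.pi = Real.pi + ρ.arg by ring,
      show ρ.arg - Real.pi = -Real.pi + ρ.arg by ring, ← Set.preimage_sub_const_Ioc]
    exact (measurePreserving_sub_right volume ρ.arg).setLIntegral_comp_preimage
      measurableSet_Ioc
      (f := fun t => ENNReal.ofReal (|t| / (2 * Real.pi)) ^ (-(1 / 2) : ℝ)) (by fun_prop)
  rw [hshift, ← htrans]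
  refine setLIntegral_mono' measurableSet_Ioc fun t ht => ?_
  refine ennreal_rpow_neg_le_rpow_neg (by norm_num) (ENNReal.ofReal_le_ofReal ?_)
  refine abs_sub_arg_div_le_norm_exp_sub_div ρ (abs_le.2 ⟨?_, ?_⟩) <;> linarith [ht.1, ht.2]

/-! ### Negative moments of polynomials on the unit circle -/

open Polynomial in
/-- A complex polynomial of degree at most `n` has a negative moment of order `δ ≤ 1 / (2n)` on the
unit circle, controlled by its Mahler measure. -/
theorem exists_lintegral_norm_eval_rpow_neg_le (n : ℕ) {δ : ℝ} (hδ : 0 < δ) (hn : n * δ ≤ 1 / 2) :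
    ∃ C : ℝ≥0∞, C ≠ ∞ ∧ C ≠ 0 ∧ ∀ P : ℂ[X], P.natDegree ≤ n →
      ∫⁻ z, ‖P.eval z‖ₑ ^ (-δ) ∂uniformUnitCircle
        ≤ C * ENNReal.ofReal P.mahlerMeasure ^ (-δ) := by
  obtain ⟨C, hC, hle⟩ := exists_lintegral_norm_sub_div_le
  refine ⟨1 + n * C, by finiteness, by simp, fun P hP => ?_⟩
  by_cases hP0 : P = 0
  · simp [hP0, ENNReal.zero_rpow_of_neg (neg_lt_zero.2 hδ), ENNReal.mul_top]
  set q : ℂ → ℂ → ℝ := fun z ρ => ‖z - ρ‖ / max 1 ‖ρ‖ with hq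
  have hm : ∀ ρ : ℂ, 0 < max 1 ‖ρ‖ := fun ρ => lt_of_lt_of_le one_pos (le_max_left _ _)
  have hq0 : ∀ z ρ, 0 ≤ q z ρ := fun z ρ => div_nonneg (norm_nonneg _) (hm ρ).le
  set y : ℂ → ℂ → ℝ≥0∞ := fun z ρ => ENNReal.ofReal (q z ρ) ^ (-(1 / 2) : ℝ) with hy
  -- `‖P z‖` is the Mahler measure times the product of the normalised distances to the roots
  have heval : ∀ z, ‖P.eval z‖ = P.mahlerMeasure * (P.roots.map (q z)).prod := by
    intro z
    have hprod : ∀ s : Multiset ℂ, ‖(s.map fun ρ => z - ρ).prod‖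
        = (s.map fun ρ => max 1 ‖ρ‖).prod * (s.map (q z)).prod := by
      intro s
      induction s using Multiset.induction with
      | empty => simp
      | cons a s ih =>
        simp only [Multiset.map_cons, Multiset.prod_cons, norm_mul, ih, hq]
        field_simp [(hm a).ne']
    conv_lhs => rw [(IsAlgClosed.splits P).eq_prod_roots]
    rw [eval_mul, eval_C, eval_multiset_prod, norm_mul, Multiset.map_map,
      mahlerMeasure_eq_leadingCoeff_mul_prod_roots, mul_assoc, ← hprod]
    simp
  have hprodle : ∀ (z : ℂ) (Y : ℝ≥0∞) (s : Multiset ℂ), (∀ ρ ∈ s, y z ρ ≤ Y) →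
      ENNReal.ofReal (s.map (q z)).prod ^ (-δ) ≤ (Y ^ (2 * δ)) ^ s.card := by
    intro z Y s
    induction s using Multiset.induction with
    | empty => simp
    | cons a s ih =>
      intro h
      have h1 : ENNReal.ofReal (q z a) ^ (-δ) ≤ Y ^ (2 * δ) := by
        have : ENNReal.ofReal (q z a) ^ (-δ) = y z a ^ (2 * δ) := by
          rw [hy, ← ENNReal.rpow_mul]; congr 1; ring
        rw [this]
        exact ENNReal.rpow_le_rpow (h a (Multiset.mem_cons_self a s)) (by positivity)
      rw [Multiset.map_cons, Multiset.prod_cons, ENNReal.ofReal_mul (hq0 z a),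
        ENNReal.mul_rpow_of_ne_top ENNReal.ofReal_ne_top ENNReal.ofReal_ne_top,
        Multiset.card_cons, pow_succ']
      exact mul_le_mul' h1 (ih fun ρ hρ => h ρ (Multiset.mem_cons_of_mem hρ))
  have hcard : (P.roots.card : ℝ) ≤ n := by
    exact_mod_cast (card_roots' P).trans hP
  have hpoint : ∀ z, ‖P.eval z‖ₑ ^ (-δ)
      ≤ ENNReal.ofReal P.mahlerMeasure ^ (-δ) * (1 + (P.roots.map (y z)).sum) := by
    intro z
    rw [← ofReal_norm, heval, ENNReal.ofReal_mul P.mahlerMeasure_nonneg,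
      ENNReal.mul_rpow_of_ne_top ENNReal.ofReal_ne_top ENNReal.ofReal_ne_top]
    refine mul_le_mul' le_rfl ?_
    set Y := 1 + (P.roots.map (y z)).sum with hY
    refine (hprodle z Y P.roots fun ρ hρ => ?_).trans ?_
    · exact (Multiset.single_le_sum (fun _ _ => zero_le) _
        (Multiset.mem_map_of_mem _ hρ)).trans le_add_self
    · rw [← ENNReal.rpow_natCast, ← ENNReal.rpow_mul]
      calc Y ^ (2 * δ * (P.roots.card : ℝ)) ≤ Y ^ (1 : ℝ) :=
            ENNReal.rpow_le_rpow_of_exponent_le le_self_add (by nlinarith)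
        _ = Y := ENNReal.rpow_one _
  have hymeas : ∀ ρ, Measurable fun z => y z ρ := fun ρ => by simp only [hy, hq]; fun_prop
  have hsum : ∀ s : Multiset ℂ,
      Measurable (fun z => (s.map (y z)).sum) ∧
      ∫⁻ z, (s.map (y z)).sum ∂uniformUnitCircle ≤ s.card * C := by
    intro s
    induction s using Multiset.induction with
    | empty => simp
    | cons a s ih =>
      simp only [Multiset.map_cons, Multiset.sum_cons, Multiset.card_cons]
      refine ⟨(hymeas a).add ih.1, ?_⟩
      rw [lintegral_add_left (hymeas a)]
      push_cast
      rw [add_mul, one_mul, add_comm (_ * C)]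
      exact add_le_add (hle a) ih.2
  calc ∫⁻ z, ‖P.eval z‖ₑ ^ (-δ) ∂uniformUnitCircle
      ≤ ∫⁻ z, ENNReal.ofReal P.mahlerMeasure ^ (-δ) * (1 + (P.roots.map (y z)).sum)
          ∂uniformUnitCircle := lintegral_mono hpoint
    _ = ENNReal.ofReal P.mahlerMeasure ^ (-δ)
          * (1 + ∫⁻ z, (P.roots.map (y z)).sum ∂uniformUnitCircle) := by
        rw [lintegral_const_mul _ ((hsum _).1.const_add 1),
          lintegral_add_left measurable_const, lintegral_const, measure_univ, one_mul]
    _ ≤ ENNReal.ofReal P.mahlerMeasure ^ (-δ) * (1 + n * C) := by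
        gcongr
        refine (hsum _).2.trans ?_
        gcongr
        exact_mod_cast hcard
    _ = _ := mul_comm _ _

/-! ### Linear combinations of Euler factors at one prime -/

/-- The Euler factor `∏_i (1 - γ_i z)⁻¹` with local parameters `γ_i`. -/
def eulerFactor {d : ℕ} (γ : Fin d → ℂ) (z : ℂ) : ℂ := ∏ i, (1 - γ i * z)⁻¹

@[fun_prop]
theorem measurable_eulerFactor {d : ℕ} (γ : Fin d → ℂ) : Measurable (eulerFactor γ) := by
  unfold eulerFactor; fun_prop

theorem one_sub_mul_ne_zero {γ z : ℂ} (hγ : ‖γ‖ < 1) (hz : ‖z‖ = 1) : 1 - γ * z ≠ 0 := by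
  intro h
  have : ‖γ * z‖ = 1 := by rw [← sub_eq_zero.1 h, norm_one]
  rw [norm_mul, hz, mul_one] at this
  exact hγ.ne this

theorem eulerFactor_ne_zero {d : ℕ} {γ : Fin d → ℂ} (hγ : ∀ i, ‖γ i‖ < 1) {z : ℂ}
    (hz : ‖z‖ = 1) : eulerFactor γ z ≠ 0 :=
  Finset.prod_ne_zero_iff.2 fun i _ => inv_ne_zero (one_sub_mul_ne_zero (hγ i) hz)

theorem norm_inv_eulerFactor_le {d : ℕ} {γ : Fin d → ℂ} (hγ : ∀ i, ‖γ i‖ < 1) {z : ℂ}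
    (hz : ‖z‖ = 1) : ‖(eulerFactor γ z)⁻¹‖ ≤ 2 ^ d := by
  rw [eulerFactor, ← Finset.prod_inv_distrib, norm_prod]
  calc ∏ i, ‖(1 - γ i * z)⁻¹⁻¹‖ ≤ ∏ _i : Fin d, (2 : ℝ) := by
        refine Finset.prod_le_prod (fun _ _ => norm_nonneg _) fun i _ => ?_
        rw [inv_inv]
        refine (norm_sub_le _ _).trans ?_
        rw [norm_one, norm_mul, hz, mul_one]
        linarith [hγ i]
    _ = 2 ^ d := by simp

open Polynomial in
theorem coeff_zero_one_finset_prod {ι : Type*} (s : Finset ι) (f : ι → ℂ[X])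
    (hf : ∀ i ∈ s, (f i).coeff 0 = 1) :
    (∏ i ∈ s, f i).coeff 0 = 1 ∧ (∏ i ∈ s, f i).coeff 1 = ∑ i ∈ s, (f i).coeff 1 := by
  classical
  induction s using Finset.induction_on with
  | empty => simp [coeff_one]
  | insert a s ha ih =>
    obtain ⟨h0, h1⟩ := ih fun i hi => hf i (Finset.mem_insert_of_mem hi)
    have hfa := hf a (Finset.mem_insert_self a s)
    rw [Finset.prod_insert ha, Finset.sum_insert ha, mul_coeff_zero, mul_coeff_one, h0, h1, hfa]
    simp [add_comm]

theorem rpow_neg_le_mul_of_le_mul {δ c : ℝ} (hδ : 0 < δ) (hc : 0 < c) {x y : ℝ≥0∞}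
    (hy : y ≠ ∞) (h : x ≤ ENNReal.ofReal c * y) :
    y ^ (-δ) ≤ ENNReal.ofReal c ^ δ * x ^ (-δ) := by
  have hc0 : ENNReal.ofReal c ≠ 0 := by simpa using hc
  have h1 := ennreal_rpow_neg_le_rpow_neg hδ.le h
  rw [ENNReal.mul_rpow_of_ne_top ENNReal.ofReal_ne_top hy] at h1
  calc y ^ (-δ) = ENNReal.ofReal c ^ δ * (ENNReal.ofReal c ^ (-δ) * y ^ (-δ)) := by
        rw [← mul_assoc, ← ENNReal.rpow_add _ _ hc0 ENNReal.ofReal_ne_top, add_neg_cancel,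
          ENNReal.rpow_zero, one_mul]
    _ ≤ _ := mul_le_mul' le_rfl h1

open Polynomial in
/-- A linear combination of Euler factors at one prime, divided by one of them, has a negative
moment controlled by the linear functional `a ↦ ∑_j a_j (s_j - s_m)`, where `s_j` is the linear
Taylor coefficient of the `j`-th factor. This functional does not see the `m`-th term. -/
theorem exists_lintegral_sum_eulerFactor_rpow_neg_le (J d : ℕ) {δ : ℝ} (hδ : 0 < δ)
    (hJd : (J * d : ℕ) * δ ≤ 1 / 2) :
    ∃ C : ℝ≥0∞, C ≠ ∞ ∧ C ≠ 0 ∧ ∀ γ : Fin J → Fin d → ℂ, (∀ j i, ‖γ j i‖ < 1) →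
      ∀ (j₀ m : Fin J) (a : Fin J → ℂ),
        ∫⁻ z, ‖∑ j, a j * (eulerFactor (γ j) z / eulerFactor (γ j₀) z)‖ₑ ^ (-δ)
            ∂uniformUnitCircle
          ≤ C * ‖∑ j, a j * (∑ i, γ j i - ∑ i, γ m i)‖ₑ ^ (-δ) := by
  obtain ⟨C, hC, hC0, hle⟩ := exists_lintegral_norm_eval_rpow_neg_le (J * d) hδ hJd
  set n := J * d with hn
  set K : ℝ := 3 * n + 1 with hK
  have hKpos : 0 < K := by positivity
  set A : ℝ≥0∞ := ENNReal.ofReal ((2 : ℝ) ^ n) ^ δ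
  set B : ℝ≥0∞ := ENNReal.ofReal K ^ δ
  have hA : A ≠ ∞ := ENNReal.rpow_ne_top_of_nonneg hδ.le ENNReal.ofReal_ne_top
  have hB : B ≠ ∞ := ENNReal.rpow_ne_top_of_nonneg hδ.le ENNReal.ofReal_ne_top
  have hA0 : A ≠ 0 := by simp [A, ENNReal.rpow_eq_zero_iff, hδ.not_gt]
  have hB0 : B ≠ 0 := by simp [B, ENNReal.rpow_eq_zero_iff, hδ.not_gt, hKpos]
  refine ⟨A * (C * B), by finiteness, by simp [hA0, hB0, hC0], fun γ hγ j₀ m a => ?_⟩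
  set fac : Fin J → ℂ[X] := fun j => ∏ i, (1 - Polynomial.C (γ j i) * X) with hfac
  set P : ℂ[X] := ∑ j, Polynomial.C (a j) * ∏ l ∈ Finset.univ.erase j, fac l with hPdef
  set s : Fin J → ℂ := fun j => ∑ i, γ j i with hs
  have hfac01 : ∀ j, (fac j).coeff 0 = 1 ∧ (fac j).coeff 1 = -s j := by
    intro j
    have := coeff_zero_one_finset_prod Finset.univ
      (fun i => (1 - Polynomial.C (γ j i) * X : ℂ[X])) (fun i _ => by simp)
    refine ⟨this.1, this.2.trans ?_⟩
    simp [hs, coeff_one]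
  have hfaceval : ∀ j z, (fac j).eval z = (eulerFactor (γ j) z)⁻¹ := by
    intro j z
    simp [hfac, eulerFactor, eval_prod]
  have hfacdeg : ∀ j, (fac j).natDegree ≤ d := by
    intro j
    refine (natDegree_prod_le _ _).trans ?_
    calc ∑ i, (1 - Polynomial.C (γ j i) * X : ℂ[X]).natDegree ≤ ∑ _i : Fin d, 1 := by
          refine Finset.sum_le_sum fun i _ => ?_
          refine (natDegree_sub_le _ _).trans ?_
          simpa using (natDegree_C_mul_le (γ j i) X).trans natDegree_X_le
      _ = d := by simp
  have hPdeg : P.natDegree ≤ n := by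
    refine natDegree_sum_le_of_forall_le _ _ fun j _ => ?_
    refine (natDegree_C_mul_le _ _).trans ((natDegree_prod_le _ _).trans ?_)
    calc ∑ l ∈ Finset.univ.erase j, (fac l).natDegree
        ≤ ∑ l : Fin J, (fac l).natDegree :=
          Finset.sum_le_sum_of_subset (Finset.erase_subset _ _)
      _ ≤ ∑ _l : Fin J, d := Finset.sum_le_sum fun l _ => hfacdeg l
      _ = n := by simp [hn]
  have hP0 : P.coeff 0 = ∑ j, a j := by
    rw [hPdef, finsetSum_coeff]
    refine Finset.sum_congr rfl fun j _ => ?_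
    rw [coeff_C_mul, (coeff_zero_one_finset_prod _ fac fun l _ => (hfac01 l).1).1, mul_one]
  have hP1 : P.coeff 1 = ∑ j, a j * (s j - ∑ l, s l) := by
    rw [hPdef, finsetSum_coeff]
    refine Finset.sum_congr rfl fun j _ => ?_
    rw [coeff_C_mul, (coeff_zero_one_finset_prod _ fac fun l _ => (hfac01 l).1).2,
      ← Finset.add_sum_erase _ s (Finset.mem_univ j)]
    simp [(hfac01 _).2]
  have hM := P.mahlerMeasure_nonneg
  -- the functional is a combination of the two lowest coefficients of `P`
  have hfun : ‖∑ j, a j * (s j - s m)‖ ≤ K * P.mahlerMeasure := by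
    have h0 : ‖P.coeff 0‖ ≤ P.mahlerMeasure := by
      simpa using P.norm_coeff_le_choose_mul_mahlerMeasure 0
    have h1 : ‖P.coeff 1‖ ≤ n * P.mahlerMeasure := by
      refine (P.norm_coeff_le_choose_mul_mahlerMeasure 1).trans ?_
      rw [Nat.choose_one_right]
      gcongr
    have hsle : ∀ j, ‖s j‖ ≤ d := by
      intro j
      refine (norm_sum_le_of_le _ fun i _ => (hγ j i).le).trans ?_
      simp
    have hsum : ‖∑ l, s l‖ ≤ n := by
      refine (norm_sum_le_of_le _ fun l _ => hsle l).trans ?_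
      simp [hn]
    have hsm : ‖s m‖ ≤ n := by
      refine (hsle m).trans ?_
      have : 1 ≤ J := Nat.one_le_iff_ne_zero.2 fun h => by subst h; exact m.elim0
      exact_mod_cast Nat.le_mul_of_pos_left d this
    have heq : ∑ j, a j * (s j - s m) = P.coeff 1 + (∑ l, s l - s m) * P.coeff 0 := by
      rw [hP0, hP1, Finset.mul_sum, ← Finset.sum_add_distrib]
      exact Finset.sum_congr rfl fun j _ => by ring
    rw [heq]
    calc _ ≤ ‖P.coeff 1‖ + ‖∑ l, s l - s m‖ * ‖P.coeff 0‖ :=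
          (norm_add_le _ _).trans (by rw [norm_mul])
      _ ≤ n * P.mahlerMeasure + (n + n) * P.mahlerMeasure := by
          gcongr
          exact (norm_sub_le _ _).trans (add_le_add hsum hsm)
      _ ≤ K * P.mahlerMeasure := by rw [hK]; nlinarith
  have hnorm : ∀ z, ‖z‖ = 1 → ‖P.eval z‖
      ≤ 2 ^ n * ‖∑ j, a j * (eulerFactor (γ j) z / eulerFactor (γ j₀) z)‖ := by
    intro z hz
    have hne : ∀ j, eulerFactor (γ j) z ≠ 0 := fun j => eulerFactor_ne_zero (hγ j) hz
    have heq : P.eval z = (∏ l ∈ Finset.univ.erase j₀, (eulerFactor (γ l) z)⁻¹)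
        * ∑ j, a j * (eulerFactor (γ j) z / eulerFactor (γ j₀) z) := by
      rw [hPdef, eval_finsetSum, Finset.mul_sum]
      refine Finset.sum_congr rfl fun j _ => ?_
      rw [eval_mul, eval_C, eval_prod]
      simp_rw [hfaceval]
      have e1 := Finset.mul_prod_erase Finset.univ (fun l => (eulerFactor (γ l) z)⁻¹)
        (Finset.mem_univ j)
      have e2 := Finset.mul_prod_erase Finset.univ (fun l => (eulerFactor (γ l) z)⁻¹)
        (Finset.mem_univ j₀)
      have e3 : ∏ l ∈ Finset.univ.erase j, (eulerFactor (γ l) z)⁻¹ = eulerFactor (γ j) z *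
          ((eulerFactor (γ j₀) z)⁻¹ * ∏ l ∈ Finset.univ.erase j₀, (eulerFactor (γ l) z)⁻¹) := by
        rw [e2, ← e1, mul_inv_cancel_left₀ (hne j)]
      rw [e3, div_eq_mul_inv]; ring
    rw [heq, norm_mul, norm_prod]
    gcongr
    calc ∏ l ∈ Finset.univ.erase j₀, ‖(eulerFactor (γ l) z)⁻¹‖
        ≤ ∏ _l ∈ Finset.univ.erase j₀, (2 : ℝ) ^ d :=
          Finset.prod_le_prod (fun _ _ => norm_nonneg _)
            fun l _ => norm_inv_eulerFactor_le (hγ l) hz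
      _ = 2 ^ (d * (J - 1)) := by simp [← pow_mul, Finset.card_erase_of_mem]
      _ ≤ 2 ^ n := by
          refine pow_le_pow_right₀ (by norm_num) ?_
          rw [hn, mul_comm J]
          exact Nat.mul_le_mul_left _ (Nat.sub_le _ _)
  calc ∫⁻ z, ‖∑ j, a j * (eulerFactor (γ j) z / eulerFactor (γ j₀) z)‖ₑ ^ (-δ)
          ∂uniformUnitCircle
      ≤ ∫⁻ z, A * ‖P.eval z‖ₑ ^ (-δ) ∂uniformUnitCircle := by
        refine lintegral_mono_ae ?_
        filter_upwards [ae_norm_eq_one_uniformUnitCircle] with z hz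
        have h : ‖P.eval z‖ₑ ≤ ENNReal.ofReal (2 ^ n) *
            ‖∑ j, a j * (eulerFactor (γ j) z / eulerFactor (γ j₀) z)‖ₑ := by
          rw [← ofReal_norm, ← ofReal_norm,
            ← ENNReal.ofReal_mul (by positivity)]
          exact ENNReal.ofReal_le_ofReal (hnorm z hz)
        exact rpow_neg_le_mul_of_le_mul hδ (by positivity) (by simp) h
    _ = A * ∫⁻ z, ‖P.eval z‖ₑ ^ (-δ) ∂uniformUnitCircle := lintegral_const_mul' _ _ hA
    _ ≤ A * (C * (B * ‖∑ j, a j * (s j - s m)‖ₑ ^ (-δ))) := by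
        gcongr
        refine (hle P hPdeg).trans ?_
        gcongr
        refine rpow_neg_le_mul_of_le_mul hδ hKpos (by simp) ?_
        rw [← ofReal_norm, ← ENNReal.ofReal_mul hKpos.le]
        exact ENNReal.ofReal_le_ofReal hfun
    _ = _ := by ring

/-! ### Integrating out finitely many independent variables -/

section Elimination

variable {Ω ι κ : Type*} [MeasurableSpace Ω] {P : Measure Ω} [IsProbabilityMeasure P]
  [DecidableEq ι] [Fintype κ] {X : ι → Ω → ℂ} {ν : Measure ℂ}

/-- If the sums `∑_j a_j w_j(z)` at the index `p` have a negative moment controlled by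
`∑_j a_j lam_j`, then in a sum of products of independent factors each `w_j(X_p)` may be replaced
by the constant `lam_j`. -/
theorem lintegral_sum_prod_rpow_neg_le_erase (hind : iIndepFun X P) (hX : ∀ p, Measurable (X p))
    (hlaw : ∀ p, P.map (X p) = ν) {δ : ℝ} {C : ℝ≥0∞} {T : Finset ι} {p : ι}
    (hp : p ∈ T) {w : κ → ι → ℂ → ℂ} (hw : ∀ j q, Measurable (w j q)) (c lam : κ → ℂ)
    (h : ∀ a : κ → ℂ,
      ∫⁻ z, ‖∑ j, a j * w j p z‖ₑ ^ (-δ) ∂ν ≤ C * ‖∑ j, a j * lam j‖ₑ ^ (-δ)) :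
    ∫⁻ x, ‖∑ j, c j * ∏ q ∈ T, w j q (X q x)‖ₑ ^ (-δ) ∂P ≤
      C * ∫⁻ x, ‖∑ j, c j * (lam j * ∏ q ∈ T.erase p, w j q (X q x))‖ₑ ^ (-δ) ∂P := by
  set a : Ω → κ → ℂ := fun x j => c j * ∏ q ∈ T.erase p, w j q (X q x) with ha
  have ham : Measurable a := by
    refine measurable_pi_lambda _ fun j => measurable_const.mul ?_
    exact Finset.measurable_prod _ fun q _ => (hw j q).comp (hX q)
  have hindep : IndepFun (X p) a P := by
    have h0 := hind.indepFun_finset {p} (T.erase p) (by simp) hX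
    have h1 : Measurable fun f : ({p} : Finset ι) → ℂ => f ⟨p, Finset.mem_singleton_self p⟩ :=
      measurable_pi_apply _
    have h2 : Measurable fun (f : ↥(T.erase p) → ℂ) (j : κ) =>
        c j * ∏ q ∈ (T.erase p).attach, w j q (f q) := by
      refine measurable_pi_lambda _ fun j => measurable_const.mul ?_
      exact Finset.measurable_prod _ fun q _ => (hw j q).comp (measurable_pi_apply q)
    have h3 := h0.comp h1 h2
    have h4 : a = (fun (f : ↥(T.erase p) → ℂ) (j : κ) =>
        c j * ∏ q ∈ (T.erase p).attach, w j q (f q)) ∘ fun x i => X i x := by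
      funext x j
      simp only [ha, Function.comp]
      congr 1
      exact (Finset.prod_attach (T.erase p) fun q => w j q (X q x)).symm
    rw [h4]
    exact h3
  have hprod := (indepFun_iff_map_prod_eq_prod_map_map (hX p).aemeasurable ham.aemeasurable).1
    hindep
  rw [hlaw p] at hprod
  have : IsProbabilityMeasure ν := hlaw p ▸ Measure.isProbabilityMeasure_map (hX p).aemeasurable
  have : IsProbabilityMeasure (P.map a) := Measure.isProbabilityMeasure_map ham.aemeasurable
  have hf : Measurable fun y : ℂ × (κ → ℂ) => ‖∑ j, y.2 j * w j p y.1‖ₑ ^ (-δ) := by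
    refine Measurable.pow_const (Measurable.enorm ?_) _
    refine Finset.measurable_sum _ fun j _ => Measurable.mul ?_ ((hw j p).comp measurable_fst)
    exact (measurable_pi_apply j).comp measurable_snd
  calc ∫⁻ x, ‖∑ j, c j * ∏ q ∈ T, w j q (X q x)‖ₑ ^ (-δ) ∂P
      = ∫⁻ x, ‖∑ j, a x j * w j p (X p x)‖ₑ ^ (-δ) ∂P := by
        refine lintegral_congr fun x => ?_
        congr 2
        refine Finset.sum_congr rfl fun j _ => ?_
        rw [← Finset.mul_prod_erase T _ hp, ha]; ring
    _ = ∫⁻ y, ‖∑ j, y.2 j * w j p y.1‖ₑ ^ (-δ) ∂(ν.prod (P.map a)) := by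
        rw [← hprod, lintegral_map hf ((hX p).prodMk ham)]
    _ = ∫⁻ b, ∫⁻ z, ‖∑ j, b j * w j p z‖ₑ ^ (-δ) ∂ν ∂(P.map a) :=
        lintegral_prod_symm' _ hf
    _ ≤ ∫⁻ b, C * ‖∑ j, b j * lam j‖ₑ ^ (-δ) ∂(P.map a) := lintegral_mono fun b => h b
    _ = ∫⁻ x, C * ‖∑ j, a x j * lam j‖ₑ ^ (-δ) ∂P := lintegral_map (by fun_prop) ham
    _ = C * ∫⁻ x, ‖∑ j, a x j * lam j‖ₑ ^ (-δ) ∂P := lintegral_const_mul _ (by fun_prop)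
    _ = _ := by
        congr 1
        refine lintegral_congr fun x => ?_
        congr 2
        refine Finset.sum_congr rfl fun j _ => ?_
        rw [ha]; ring

/-- The iterated form of `lintegral_sum_prod_rpow_neg_le_erase`, for all indices of `S`. -/
theorem lintegral_sum_prod_rpow_neg_le_ite (hind : iIndepFun X P) (hX : ∀ p, Measurable (X p))
    (hlaw : ∀ p, P.map (X p) = ν) {δ : ℝ} {C : ℝ≥0∞} {T : Finset ι}
    {w : κ → ι → ℂ → ℂ} (hw : ∀ j q, Measurable (w j q)) (c : κ → ℂ) (lam : κ → ι → ℂ)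
    (S : Finset ι) (hST : S ⊆ T)
    (h : ∀ p ∈ S, ∀ a : κ → ℂ,
      ∫⁻ z, ‖∑ j, a j * w j p z‖ₑ ^ (-δ) ∂ν ≤ C * ‖∑ j, a j * lam j p‖ₑ ^ (-δ)) :
    ∫⁻ x, ‖∑ j, c j * ∏ q ∈ T, w j q (X q x)‖ₑ ^ (-δ) ∂P ≤
      C ^ S.card * ∫⁻ x, ‖∑ j, c j * ∏ q ∈ T,
        (if q ∈ S then lam j q else w j q (X q x))‖ₑ ^ (-δ) ∂P := by
  induction S using Finset.induction_on with
  | empty => simp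
  | insert p S hpS ih =>
    have hpT : p ∈ T := hST (Finset.mem_insert_self p S)
    refine (ih ((Finset.subset_insert p S).trans hST)
      fun q hq => h q (Finset.mem_insert_of_mem hq)).trans ?_
    rw [Finset.card_insert_of_notMem hpS, pow_succ, mul_assoc]
    refine mul_le_mul' le_rfl ?_
    refine (lintegral_sum_prod_rpow_neg_le_erase (C := C) (w := fun j q z => if q ∈ S then lam j q else w j q z)
      hind hX hlaw hpT (fun j q => ?_) c (fun j => lam j p) fun a => ?_).trans_eq ?_
    · split_ifs
      exacts [measurable_const, hw j q]
    · simpa [hpS] using h p (Finset.mem_insert_self p S) a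
    · congr 1
      refine lintegral_congr fun x => ?_
      congr 2
      refine Finset.sum_congr rfl fun j _ => ?_
      rw [← Finset.mul_prod_erase T _ hpT, if_pos (Finset.mem_insert_self p S)]
      congr 2
      refine Finset.prod_congr rfl fun q hq => ?_
      simp [Finset.ne_of_mem_erase hq]

end Elimination

/-! ### Sums of bounded independent variables -/

section Bernstein

variable {Ω ι : Type*} [MeasurableSpace Ω] {P : Measure Ω} [IsProbabilityMeasure P]

theorem integrable_of_abs_le {Y : Ω → ℝ} (hY : Measurable Y) {M : ℝ} (hM : ∀ x, |Y x| ≤ M) :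
    Integrable Y P :=
  Integrable.of_bound hY.aestronglyMeasurable M (Eventually.of_forall hM)

/-- Bernstein's bound: for small `t` the moment generating function of a bounded centred variable is
that of a Gaussian, up to constants in the variance. -/
theorem mgf_le_exp_sq_mul {Y : Ω → ℝ} (hY : Measurable Y) {M v t : ℝ} (hM : ∀ x, |Y x| ≤ M)
    (hmean : ∫ x, Y x ∂P = 0) (hv : ∀ x, Y x ^ 2 ≤ v) (ht : |t| * M ≤ 1) :
    mgf Y P t ≤ Real.exp (t ^ 2 * v) := by
  have hint := integrable_of_abs_le (P := P) hY hM
  have hle : ∀ x, |t * Y x| ≤ 1 := fun x => by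
    rw [abs_mul]; exact (mul_le_mul_of_nonneg_left (hM x) (abs_nonneg t)).trans ht
  have hpt : ∀ x, Real.exp (t * Y x) ≤ (1 + t ^ 2 * v) + t * Y x := by
    intro x
    have h1 := (abs_le.1 (Real.abs_exp_sub_one_sub_id_le (hle x))).2
    have h2 := mul_le_mul_of_nonneg_left (hv x) (sq_nonneg t)
    nlinarith
  have hexp : Integrable (fun x => Real.exp (t * Y x)) P := by
    refine integrable_of_abs_le (M := Real.exp 1) (by fun_prop) fun x => ?_
    rw [abs_of_pos (Real.exp_pos _)]
    exact Real.exp_le_exp.2 ((le_abs_self _).trans (hle x))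
  calc mgf Y P t ≤ ∫ x, ((1 + t ^ 2 * v) + t * Y x) ∂P :=
        integral_mono hexp ((integrable_const _).add (hint.const_mul t)) hpt
    _ = 1 + t ^ 2 * v := by
        rw [integral_add (integrable_const _) (hint.const_mul t), integral_const_mul, hmean]
        simp
    _ ≤ Real.exp (t ^ 2 * v) := by linarith [Real.add_one_le_exp (t ^ 2 * v)]

theorem mgf_sum_le_exp_sq_mul {Y : ι → Ω → ℝ} (hind : iIndepFun Y P)
    (hY : ∀ i, Measurable (Y i)) {M t V : ℝ} {v : ι → ℝ} (hM : ∀ i x, |Y i x| ≤ M)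
    (hmean : ∀ i, ∫ x, Y i x ∂P = 0) (hv : ∀ i x, Y i x ^ 2 ≤ v i) (ht : |t| * M ≤ 1)
    (s : Finset ι) (hV : ∑ i ∈ s, v i ≤ V) :
    mgf (∑ i ∈ s, Y i) P t ≤ Real.exp (t ^ 2 * V) := by
  rw [hind.mgf_sum hY s]
  calc ∏ i ∈ s, mgf (Y i) P t ≤ ∏ i ∈ s, Real.exp (t ^ 2 * v i) :=
        Finset.prod_le_prod (fun _ _ => mgf_nonneg)
          fun i _ => mgf_le_exp_sq_mul (hY i) (hM i) (hmean i) (hv i) ht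
    _ = Real.exp (t ^ 2 * ∑ i ∈ s, v i) := by rw [← Real.exp_sum, Finset.mul_sum]
    _ ≤ _ := by gcongr

theorem integrable_exp_mul_sum {Y : ι → Ω → ℝ} (hY : ∀ i, Measurable (Y i)) {M : ℝ}
    (hM : ∀ i x, |Y i x| ≤ M) (s : Finset ι) (t : ℝ) :
    Integrable (fun x => Real.exp (t * (∑ i ∈ s, Y i) x)) P := by
  have hm : Measurable (∑ i ∈ s, Y i) := by fun_prop
  refine integrable_of_abs_le (M := Real.exp (|t| * (s.card * M)))
    (Real.measurable_exp.comp (measurable_const.mul hm)) fun x => ?_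
  rw [abs_of_pos (Real.exp_pos _)]
  refine Real.exp_le_exp.2 ((le_abs_self _).trans ?_)
  rw [abs_mul, Finset.sum_apply]
  gcongr
  refine (Finset.abs_sum_le_sum_abs _ _).trans ?_
  refine (Finset.sum_le_sum fun i _ => hM i x).trans_eq ?_
  simp

/-- A series of bounded, centred independent variables with summable variances converges almost
surely: its partial sums are a martingale, bounded in `L¹` because they have bounded exponential
moments. -/
theorem ae_exists_tendsto_sum_range {Y : ℕ → Ω → ℝ} (hind : iIndepFun Y P)
    (hY : ∀ i, Measurable (Y i)) {M V : ℝ} {v : ℕ → ℝ} (hM : ∀ i x, |Y i x| ≤ M)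
    (hmean : ∀ i, ∫ x, Y i x ∂P = 0) (hv : ∀ i x, Y i x ^ 2 ≤ v i)
    (hV : ∀ s : Finset ℕ, ∑ i ∈ s, v i ≤ V) :
    ∀ᵐ x ∂P, ∃ l : ℝ, Tendsto (fun n => ∑ i ∈ Finset.range n, Y i x) atTop (𝓝 l) := by
  have hsm : ∀ i, StronglyMeasurable (Y i) := fun i => (hY i).stronglyMeasurable
  set ℱ := Filtration.natural Y hsm
  set f : ℕ → Ω → ℝ := fun n => ∑ i ∈ Finset.range (n + 1), Y i with hf
  have hint : ∀ i, Integrable (Y i) P := fun i => integrable_of_abs_le (hY i) (hM i)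
  have hfint : ∀ n, Integrable (f n) P := fun n => integrable_finsetSum' _ fun i _ => hint i
  have hadp : StronglyAdapted ℱ f := by
    intro n
    refine Finset.stronglyMeasurable_sum _ fun i hi => ?_
    exact (Filtration.stronglyAdapted_natural hsm i).mono
      (ℱ.mono (Nat.lt_succ_iff.1 (Finset.mem_range.1 hi)))
  have hmart : Martingale f ℱ P := by
    refine martingale_nat hadp hfint fun n => ?_
    have h1 : P[f (n + 1) | ℱ n] =ᵐ[P] P[f n | ℱ n] + P[Y (n + 1) | ℱ n] := by
      have : f (n + 1) = f n + Y (n + 1) := by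
        simp only [hf]; rw [Finset.sum_range_succ]
      rw [this]
      exact condExp_add (hfint n) (hint _) _
    have h2 : P[Y (n + 1) | ℱ n] =ᵐ[P] fun _ => ∫ x, Y (n + 1) x ∂P :=
      hind.condExp_natural_ae_eq_of_lt hsm (Nat.lt_succ_self n)
    rw [condExp_of_stronglyMeasurable (ℱ.le n) (hadp n) (hfint n)] at h1
    filter_upwards [h1, h2] with x hx1 hx2
    rw [hx1, Pi.add_apply, hx2, hmean, add_zero]
  have hM0 : 0 ≤ M := by
    obtain ⟨x⟩ := P.nonempty_of_neZero
    exact (abs_nonneg _).trans (hM 0 x)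
  set t : ℝ := (M + 1)⁻¹ with ht
  have ht0 : 0 < t := by positivity
  have htM : |t| * M ≤ 1 := by
    rw [abs_of_pos ht0, ht, inv_mul_le_iff₀ (by positivity)]; linarith
  have htM' : |-t| * M ≤ 1 := by rwa [abs_neg]
  set R : ℝ := t⁻¹ * (Real.exp (t ^ 2 * V) + Real.exp (t ^ 2 * V))
  have hbdd : ∀ n, eLpNorm (f n) 1 P ≤ (R.toNNReal : ℝ≥0∞) := by
    intro n
    have e1 := integrable_exp_mul_sum (P := P) hY hM (Finset.range (n + 1)) t
    have e2 := integrable_exp_mul_sum (P := P) hY hM (Finset.range (n + 1)) (-t)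
    have m1 := mgf_sum_le_exp_sq_mul hind hY hM hmean hv htM _ (hV (Finset.range (n + 1)))
    have m2 := mgf_sum_le_exp_sq_mul hind hY hM hmean hv htM' _ (hV (Finset.range (n + 1)))
    rw [neg_sq] at m2
    rw [eLpNorm_one_eq_lintegral_enorm, ← ofReal_integral_norm_eq_lintegral_enorm (hfint n)]
    refine ENNReal.ofReal_le_ofReal ?_
    calc ∫ x, ‖f n x‖ ∂P
        ≤ ∫ x, t⁻¹ * (Real.exp (t * f n x) + Real.exp (-t * f n x)) ∂P := by
          refine integral_mono (hfint n).norm ((e1.add e2).const_mul _) fun x => ?_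
          simp only [Real.norm_eq_abs]
          rw [← div_eq_inv_mul, le_div_iff₀ ht0]
          have a1 := Real.add_one_le_exp (t * f n x)
          have a2 := Real.add_one_le_exp (-t * f n x)
          have a3 := Real.exp_pos (t * f n x)
          have a4 := Real.exp_pos (-t * f n x)
          rcases abs_cases (f n x) with ⟨h, _⟩ | ⟨h, _⟩ <;> rw [h] <;> nlinarith
      _ = t⁻¹ * (mgf (f n) P t + mgf (f n) P (-t)) := by
          rw [integral_const_mul, integral_add e1 e2]; rfl
      _ ≤ R := by
          simp only [R]
          gcongr
  filter_upwards [hmart.submartingale.exists_ae_tendsto_of_bdd hbdd] with x hx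
  obtain ⟨l, hl⟩ := hx
  refine ⟨l, (tendsto_add_atTop_iff_nat 1).1 ?_⟩
  simpa [hf] using hl

end Bernstein

/-! ### The logarithm of an Euler factor -/

/-- The logarithm `-∑_i log (1 - γ_i z)` of the Euler factor with local parameters `γ_i`. -/
def logEulerFactor {d : ℕ} (γ : Fin d → ℂ) (z : ℂ) : ℂ := -∑ i, Complex.log (1 - γ i * z)

@[fun_prop]
theorem measurable_logEulerFactor {d : ℕ} (γ : Fin d → ℂ) : Measurable (logEulerFactor γ) := by
  unfold logEulerFactor; fun_prop

section LogEulerFactor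

variable {d : ℕ} {γ : Fin d → ℂ} {r : ℝ}

theorem exp_logEulerFactor (hγ : ∀ i, ‖γ i‖ < 1) {z : ℂ} (hz : ‖z‖ = 1) :
    Complex.exp (logEulerFactor γ z) = eulerFactor γ z := by
  rw [logEulerFactor, eulerFactor, ← Finset.sum_neg_distrib, Complex.exp_sum]
  refine Finset.prod_congr rfl fun i _ => ?_
  rw [Complex.exp_neg, Complex.exp_log (one_sub_mul_ne_zero (hγ i) hz)]

theorem norm_neg_log_one_sub_sub_le {w : ℂ} (hr : r < 1) (hw : ‖w‖ ≤ r) :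
    ‖-Complex.log (1 - w) - w‖ ≤ (1 - r)⁻¹ * ‖w‖ ^ 2 := by
  have h := Complex.norm_log_one_add_sub_self_le (z := -w) (by rw [norm_neg]; linarith)
  rw [norm_neg] at h
  have h1 : ‖-Complex.log (1 - w) - w‖ = ‖Complex.log (1 + -w) - -w‖ := by
    rw [← norm_neg]; congr 1; rw [← sub_eq_add_neg]; ring
  have h2 : (1 - ‖w‖)⁻¹ ≤ (1 - r)⁻¹ := inv_anti₀ (by linarith) (by linarith)
  have h3 : 0 ≤ (1 - ‖w‖)⁻¹ := inv_nonneg.2 (by linarith)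
  rw [h1]
  refine h.trans ?_
  nlinarith [sq_nonneg ‖w‖, mul_le_mul_of_nonneg_left h2 (sq_nonneg ‖w‖),
    mul_nonneg (sq_nonneg ‖w‖) h3]

theorem norm_logEulerFactor_sub_le (hr : r < 1) (hγ : ∀ i, ‖γ i‖ ≤ r) {z : ℂ} (hz : ‖z‖ = 1) :
    ‖logEulerFactor γ z - (∑ i, γ i) * z‖ ≤ (1 - r)⁻¹ * ∑ i, ‖γ i‖ ^ 2 := by
  have : logEulerFactor γ z - (∑ i, γ i) * z
      = ∑ i, (-Complex.log (1 - γ i * z) - γ i * z) := by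
    rw [Finset.sum_sub_distrib, Finset.sum_neg_distrib, Finset.sum_mul, logEulerFactor]
  rw [this, Finset.mul_sum]
  refine norm_sum_le_of_le _ fun i _ => ?_
  have hn : ‖γ i * z‖ = ‖γ i‖ := by rw [norm_mul, hz, mul_one]
  have := norm_neg_log_one_sub_sub_le hr (hn.trans_le (hγ i))
  rwa [hn] at this

theorem norm_logEulerFactor_le (hr : r < 1) (hγ : ∀ i, ‖γ i‖ ≤ r) {z : ℂ} (hz : ‖z‖ = 1) :
    ‖logEulerFactor γ z‖ ≤ d * (1 + (1 - r)⁻¹) := by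
  have h1 := norm_logEulerFactor_sub_le hr hγ hz
  have hγ1 : ∀ i, ‖γ i‖ ≤ 1 := fun i => (hγ i).trans hr.le
  have h2 : ‖(∑ i, γ i) * z‖ ≤ d := by
    rw [norm_mul, hz, mul_one]
    refine (norm_sum_le_of_le _ fun i _ => hγ1 i).trans ?_
    simp
  have h3 : ∑ i, ‖γ i‖ ^ 2 ≤ d := by
    calc ∑ i, ‖γ i‖ ^ 2 ≤ ∑ _i : Fin d, (1 : ℝ) :=
          Finset.sum_le_sum fun i _ => pow_le_one₀ (norm_nonneg _) (hγ1 i)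
      _ = d := by simp
  have h4 : 0 ≤ (1 - r)⁻¹ := inv_nonneg.2 (by linarith)
  calc ‖logEulerFactor γ z‖ = ‖(logEulerFactor γ z - (∑ i, γ i) * z) + (∑ i, γ i) * z‖ := by
        rw [sub_add_cancel]
    _ ≤ (1 - r)⁻¹ * ∑ i, ‖γ i‖ ^ 2 + d := (norm_add_le _ _).trans (add_le_add h1 h2)
    _ ≤ (1 - r)⁻¹ * d + d := by gcongr
    _ = _ := by ring

/-- The bound for the squared modulus of `logEulerFactor γ` on the unit circle given by
`norm_sq_logEulerFactor_le`: the main term is the square of the linear Taylor coefficient, the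
remaining one is of fourth order in the local parameters. -/
def logEulerFactorVar (r : ℝ) (γ : Fin d → ℂ) : ℝ :=
  2 * ‖∑ i, γ i‖ ^ 2 + 2 * ((1 - r)⁻¹ ^ 2 * (d * ∑ i, ‖γ i‖ ^ 4))

theorem norm_sq_logEulerFactor_le (hr : r < 1) (hγ : ∀ i, ‖γ i‖ ≤ r) {z : ℂ} (hz : ‖z‖ = 1) :
    ‖logEulerFactor γ z‖ ^ 2 ≤ logEulerFactorVar r γ := by
  have h1 := norm_logEulerFactor_sub_le hr hγ hz
  have h2 : ‖(∑ i, γ i) * z‖ = ‖∑ i, γ i‖ := by rw [norm_mul, hz, mul_one]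
  have h3 : ‖logEulerFactor γ z‖ ≤ (1 - r)⁻¹ * ∑ i, ‖γ i‖ ^ 2 + ‖∑ i, γ i‖ := by
    calc ‖logEulerFactor γ z‖ = ‖(logEulerFactor γ z - (∑ i, γ i) * z) + (∑ i, γ i) * z‖ := by
          rw [sub_add_cancel]
      _ ≤ _ := (norm_add_le _ _).trans (add_le_add h1 h2.le)
  have h4 : (∑ i, ‖γ i‖ ^ 2) ^ 2 ≤ d * ∑ i, ‖γ i‖ ^ 4 := by
    have := sq_sum_le_card_mul_sum_sq (s := Finset.univ) (f := fun i => ‖γ i‖ ^ 2)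
    simpa [← pow_mul] using this
  rw [logEulerFactorVar]
  set a := (1 - r)⁻¹ * ∑ i, ‖γ i‖ ^ 2
  set b := ‖∑ i, γ i‖
  have h5 : a ^ 2 ≤ (1 - r)⁻¹ ^ 2 * (d * ∑ i, ‖γ i‖ ^ 4) := by
    simp only [a, mul_pow]
    gcongr
  have h6 : ‖logEulerFactor γ z‖ ^ 2 ≤ (a + b) ^ 2 :=
    pow_le_pow_left₀ (norm_nonneg _) h3 2
  nlinarith [sq_nonneg (a - b)]

theorem integral_logEulerFactor (hγ : ∀ i, ‖γ i‖ < 1) :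
    ∫ z, logEulerFactor γ z ∂uniformUnitCircle = 0 := by
  rw [integral_uniformUnitCircle (by fun_prop)]
  have hd : ∀ z ∈ Metric.closedBall (0 : ℂ) |1|, DifferentiableAt ℂ (logEulerFactor γ) z := by
    intro z hz
    simp only [abs_one, mem_closedBall_zero_iff] at hz
    unfold logEulerFactor
    refine DifferentiableAt.neg (DifferentiableAt.fun_sum fun i _ => ?_)
    refine DifferentiableAt.clog (by fun_prop) ?_
    have : ‖-(γ i * z)‖ < 1 := by
      rw [norm_neg, norm_mul]
      exact (mul_le_of_le_one_right (norm_nonneg _) hz).trans_lt (hγ i)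
    simpa [sub_eq_add_neg] using Complex.mem_slitPlane_of_norm_lt_one this
  rw [circleAverage_of_differentiable_on_off_countable Set.countable_empty
    (fun z hz => (hd z hz).continuousAt.continuousWithinAt)
    fun z hz => hd z (Metric.ball_subset_closedBall hz.1)]
  simp [logEulerFactor]

end LogEulerFactor

/-! ### Sums over primes -/

/-- Partial summation in blocks: if every prime lies below some threshold `x m` at which the weight
`w` is at most `W m`, then a weighted sum is controlled by the unweighted partial sums at the
thresholds. -/
theorem sum_mul_le_tsum_of_cover {h w : Nat.Primes → ℝ} {W D x : ℕ → ℝ} (hh : ∀ p, 0 ≤ h p)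
    (hW : ∀ m, 0 ≤ W m) (hcover : ∀ p : Nat.Primes, ∃ m, (p : ℝ) ≤ x m ∧ w p ≤ W m)
    (hD : ∀ m, ∑ p ∈ primesUpTo ⌊x m⌋₊, h p ≤ D m) (hsum : Summable fun m => W m * D m)
    (s : Finset Nat.Primes) : ∑ p ∈ s, h p * w p ≤ ∑' m, W m * D m := by
  classical
  choose m hm using hcover
  have hD0 : ∀ k, 0 ≤ D k := fun k => (Finset.sum_nonneg fun p _ => hh p).trans (hD k)
  calc ∑ p ∈ s, h p * w p ≤ ∑ p ∈ s, h p * W (m p) :=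
        Finset.sum_le_sum fun p _ => mul_le_mul_of_nonneg_left (hm p).2 (hh p)
    _ = ∑ k ∈ s.image m, ∑ p ∈ s with m p = k, h p * W (m p) :=
        (Finset.sum_fiberwise_of_maps_to (fun p hp => Finset.mem_image_of_mem m hp) _).symm
    _ ≤ ∑ k ∈ s.image m, W k * D k := by
        refine Finset.sum_le_sum fun k _ => ?_
        have : ∑ p ∈ s with m p = k, h p * W (m p) = W k * ∑ p ∈ s with m p = k, h p := by
          rw [Finset.mul_sum]
          refine Finset.sum_congr rfl fun p hp => ?_
          rw [(Finset.mem_filter.1 hp).2, mul_comm]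
        rw [this]
        refine mul_le_mul_of_nonneg_left (le_trans ?_ (hD k)) (hW k)
        refine Finset.sum_le_sum_of_subset_of_nonneg (fun p hp => ?_) fun p _ _ => hh p
        obtain ⟨_, rfl⟩ := Finset.mem_filter.1 hp
        exact mem_primesUpTo.2 (Nat.le_floor (hm p).1)
    _ ≤ ∑' m, W m * D m := hsum.sum_le_tsum _ fun k _ => mul_nonneg (hW k) (hD0 k)

/-- If `∑_{p ≤ x} h(p) ≪ x ^ (1 + ε)` then `∑_p h(p) p ^ (-(1 + 2ε))` is bounded. -/
theorem exists_sum_mul_rpow_neg_le {h : Nat.Primes → ℝ} (hh : ∀ p, 0 ≤ h p) {ε : ℝ} (hε : 0 < ε)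
    (hO : (fun x : ℝ => ∑ p ∈ primesUpTo ⌊x⌋₊, h p) =O[atTop] fun x : ℝ => x ^ (1 + ε)) :
    ∃ B : ℝ, ∀ s : Finset Nat.Primes, ∑ p ∈ s, h p * (p : ℝ) ^ (-(1 + 2 * ε)) ≤ B := by
  obtain ⟨C, hC⟩ := hO.bound
  obtain ⟨x₀, hx₀⟩ := eventually_atTop.1 hC
  set x₁ : ℝ := max x₀ 1
  have hx₁ : 1 ≤ x₁ := le_max_right _ _
  set κ : ℝ := 1 + 2 * ε with hκ
  set W : ℕ → ℝ := fun m => 2 ^ κ * ((2 : ℝ) ^ (-κ)) ^ m with hWdef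
  set D : ℕ → ℝ := fun m => C * (x₁ ^ (1 + ε) * ((2 : ℝ) ^ (1 + ε)) ^ m) with hDdef
  refine ⟨∑' m, W m * D m, sum_mul_le_tsum_of_cover (x := fun m => x₁ * 2 ^ m) hh
    (fun m => by positivity) ?_ ?_ ?_⟩
  · intro p
    have hp1 : (1 : ℝ) ≤ p := by exact_mod_cast p.2.one_lt.le
    have hex : ∃ m : ℕ, (p : ℝ) ≤ x₁ * 2 ^ m := by
      obtain ⟨m, hm⟩ := pow_unbounded_of_one_lt (p : ℝ) (one_lt_two)
      refine ⟨m, hm.le.trans ?_⟩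
      nlinarith [pow_pos (two_pos : (0 : ℝ) < 2) m]
    classical
    refine ⟨Nat.find hex, Nat.find_spec hex, ?_⟩
    rcases Nat.eq_zero_or_pos (Nat.find hex) with h0 | h0
    · rw [h0, hWdef]
      simp only [pow_zero, mul_one]
      exact (Real.rpow_le_one_of_one_le_of_nonpos hp1 (by linarith)).trans
        (Real.one_le_rpow one_le_two (by linarith))
    · obtain ⟨n, hn⟩ : ∃ n, Nat.find hex = n + 1 := ⟨_, (Nat.succ_pred_eq_of_pos h0).symm⟩
      have hlt : x₁ * 2 ^ n < p := not_le.1 (Nat.find_min hex (by omega))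
      have hle : (2 : ℝ) ^ n ≤ p := by nlinarith [pow_pos (two_pos : (0 : ℝ) < 2) n]
      have hWn : W (n + 1) = ((2 : ℝ) ^ n) ^ (-κ) := by
        simp only [hWdef]
        rw [pow_succ, mul_comm (_ ^ n), ← mul_assoc, ← Real.rpow_add two_pos, add_neg_cancel,
          Real.rpow_zero, one_mul, ← Real.rpow_natCast, ← Real.rpow_natCast, ← Real.rpow_mul
          two_pos.le, ← Real.rpow_mul two_pos.le, mul_comm]
      rw [hn, hWn]
      exact Real.rpow_le_rpow_of_nonpos (by positivity) hle (by linarith)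
  · intro m
    have h2m : (1 : ℝ) ≤ 2 ^ m := one_le_pow₀ one_le_two
    have := hx₀ (x₁ * 2 ^ m) ((le_max_left _ _).trans (le_mul_of_one_le_right (by linarith) h2m))
    rw [Real.norm_of_nonneg (Finset.sum_nonneg fun p _ => hh p),
      Real.norm_of_nonneg (by positivity)] at this
    refine this.trans_eq ?_
    rw [hDdef, Real.mul_rpow (by linarith) (by positivity)]
    congr 2
    rw [← Real.rpow_natCast, ← Real.rpow_natCast, ← Real.rpow_mul two_pos.le,
      ← Real.rpow_mul two_pos.le, mul_comm]
  · have : (fun m => W m * D m)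
        = fun m => (2 ^ κ * (C * x₁ ^ (1 + ε))) * ((2 : ℝ) ^ (-ε)) ^ m := by
      funext m
      have : ((2 : ℝ) ^ (-ε)) ^ m = ((2 : ℝ) ^ (-κ)) ^ m * ((2 : ℝ) ^ (1 + ε)) ^ m := by
        rw [← mul_pow, ← Real.rpow_add two_pos]
        congr 2; rw [hκ]; ring
      rw [this, hWdef, hDdef]; ring
    rw [this]
    refine (summable_geometric_of_lt_one (by positivity) ?_).mul_left _
    exact Real.rpow_lt_one_of_one_lt_of_neg one_lt_two (by linarith)

/-- If `∑_{p ≤ x} h(p) ≪ log log x` then `∑_p h(p) p ^ (-2 / G) ≪ log log T`, uniformly for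
`0 < G ≤ log T`. -/
theorem exists_sum_mul_rpow_neg_le_log_log {h : Nat.Primes → ℝ} (hh : ∀ p, 0 ≤ h p) {C x₀ : ℝ}
    (hx₀ : Real.exp (Real.exp 1) ≤ x₀)
    (hH : ∀ x : ℝ, x₀ ≤ x → ∑ p ∈ primesUpTo ⌊x⌋₊, h p ≤ C * Real.log (Real.log x)) :
    ∃ B : ℝ, ∀ T G : ℝ, x₀ ≤ T → 0 < G → G ≤ Real.log T → ∀ s : Finset Nat.Primes,
      ∑ p ∈ s, h p * (p : ℝ) ^ (-(2 / G)) ≤ B * Real.log (Real.log T) := by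
  have hC : 0 ≤ C := by
    have h1 := (Finset.sum_nonneg fun p _ => hh p).trans (hH (Real.exp (Real.exp 1)  ⊔ x₀)
      (le_max_right _ _))
    have h2 : 0 < Real.log (Real.log (Real.exp (Real.exp 1) ⊔ x₀)) := by
      have h3 : Real.exp 1 ≤ Real.log (Real.exp (Real.exp 1) ⊔ x₀) :=
        (Real.le_log_iff_exp_le (by positivity)).2 (le_max_left _ _)
      exact Real.log_pos ((Real.one_lt_exp_iff.2 one_pos).trans_le h3)
    exact nonneg_of_mul_nonneg_left h1 h2
  refine ⟨∑' m : ℕ, Real.exp (-2) ^ m * (C * (m + 1)), fun T G hT hG hGT s => ?_⟩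
  have hT0 : 0 < T := (Real.exp_pos _).trans_le (hx₀.trans hT)
  have hlogT : Real.exp 1 ≤ Real.log T :=
    (Real.le_log_iff_exp_le hT0).2 (hx₀.trans hT)
  have hlogT0 : 0 < Real.log T := (Real.exp_pos _).trans_le hlogT
  have hT1 : 1 < T := (Real.log_pos_iff hT0.le).1 hlogT0
  have hll : 1 ≤ Real.log (Real.log T) := (Real.le_log_iff_exp_le hlogT0).2 hlogT
  have hsum : Summable fun m : ℕ => Real.exp (-2) ^ m * (C * (m + 1)) := by
    have hlt : ‖Real.exp (-2)‖ < 1 := by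
      rw [Real.norm_of_nonneg (Real.exp_pos _).le]; exact Real.exp_lt_one_iff.2 (by norm_num)
    have h1 := (summable_pow_mul_geometric_of_norm_lt_one 1 hlt).mul_left C
    have h2 := (summable_geometric_of_norm_lt_one hlt).mul_left C
    refine (h1.add h2).congr fun m => ?_
    ring
  have key := sum_mul_le_tsum_of_cover (h := h) (w := fun p => (p : ℝ) ^ (-(2 / G)))
    (W := fun m => Real.exp (-2) ^ m) (D := fun m => C * (m + 1) * Real.log (Real.log T))
    (x := fun m => T ^ (m + 1)) hh (fun m => by positivity) ?_ ?_ ?_ s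
  · refine key.trans_eq ?_
    rw [← tsum_mul_right]
    exact tsum_congr fun m => by ring
  · intro p
    have hp1 : (1 : ℝ) ≤ p := by exact_mod_cast p.2.one_lt.le
    have hex : ∃ m : ℕ, (p : ℝ) ≤ T ^ (m + 1) := by
      obtain ⟨m, hm⟩ := pow_unbounded_of_one_lt (p : ℝ) hT1
      exact ⟨m, hm.le.trans (pow_le_pow_right₀ hT1.le (Nat.le_succ m))⟩
    classical
    refine ⟨Nat.find hex, Nat.find_spec hex, ?_⟩
    rcases Nat.eq_zero_or_pos (Nat.find hex) with h0 | h0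
    · rw [h0, pow_zero]
      exact Real.rpow_le_one_of_one_le_of_nonpos hp1 (by rw [neg_nonpos]; positivity)
    · obtain ⟨n, hn⟩ : ∃ n, Nat.find hex = n + 1 := ⟨_, (Nat.succ_pred_eq_of_pos h0).symm⟩
      have hlt : T ^ (n + 1) < p := not_le.1 (Nat.find_min hex (by omega))
      have hlog : (n + 1 : ℕ) * Real.log T ≤ Real.log p := by
        rw [← Real.log_pow]; exact Real.log_le_log (by positivity) hlt.le
      rw [hn, Real.rpow_def_of_pos (by linarith), ← Real.exp_nat_mul]
      refine Real.exp_le_exp.2 ?_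
      have h2 : 2 * ((n + 1 : ℕ) : ℝ) ≤ Real.log p * (2 / G) := by
        rw [mul_div_assoc', le_div_iff₀ hG]
        have : ((n + 1 : ℕ) : ℝ) * G ≤ (n + 1 : ℕ) * Real.log T := by gcongr
        linarith
      linarith
  · intro m
    have hm0 : (0 : ℝ) < m + 1 := by positivity
    have hTm : x₀ ≤ T ^ (m + 1) := hT.trans (le_self_pow₀ hT1.le (Nat.succ_ne_zero m))
    refine (hH _ hTm).trans ?_
    rw [mul_assoc]
    refine mul_le_mul_of_nonneg_left ?_ hC
    rw [Real.log_pow, Nat.cast_succ, Real.log_mul hm0.ne' hlogT0.ne']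
    have := Real.log_le_sub_one_of_pos hm0
    nlinarith [(Nat.cast_nonneg m : (0 : ℝ) ≤ m)]
  · refine (hsum.mul_right (Real.log (Real.log T))).congr fun m => ?_
    ring

/-! ### Consequences of the assumptions on the family -/

/-- The local parameters `α_{j,i}(p) p ^ (-σ)`, in the variable `X(p)`. -/
def localParam {J d : ℕ} (α : Fin J → Fin d → Nat.Primes → ℂ) (σ : ℝ) (j : Fin J)
    (p : Nat.Primes) (i : Fin d) : ℂ :=
  α j i p / (((p : ℝ) ^ σ : ℝ) : ℂ)

section Family

variable {J d : ℕ} {L : Fin J → ℂ → ℂ} {α : Fin J → Fin d → Nat.Primes → ℂ}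

theorem eulerLogCoeff_one (α : Fin J → Fin d → Nat.Primes → ℂ) (j : Fin J) (p : Nat.Primes) :
    eulerLogCoeff α j p 1 = ∑ i, α j i p := by simp [eulerLogCoeff]

theorem sum_localParam (α : Fin J → Fin d → Nat.Primes → ℂ) (σ : ℝ) (j : Fin J)
    (p : Nat.Primes) :
    ∑ i, localParam α σ j p i = eulerLogCoeff α j p 1 / (((p : ℝ) ^ σ : ℝ) : ℂ) := by
  simp [localParam, eulerLogCoeff_one, Finset.sum_div]

theorem norm_localParam (α : Fin J → Fin d → Nat.Primes → ℂ) (σ : ℝ) (j : Fin J)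
    (p : Nat.Primes) (i : Fin d) :
    ‖localParam α σ j p i‖ = ‖α j i p‖ / (p : ℝ) ^ σ := by
  rw [localParam, norm_div, Complex.norm_real, Real.norm_of_nonneg (by positivity)]

theorem randomLPartial_eq_prod_eulerFactor (α : Fin J → Fin d → Nat.Primes → ℂ) (σ : ℝ)
    (x : Nat.Primes → ℂ) (j : Fin J) (N : ℕ) :
    randomLPartial α σ x j N = ∏ p ∈ primesUpTo N, eulerFactor (localParam α σ j p) (x p) := by
  simp only [randomLPartial, eulerFactor, localParam]
  refine Finset.prod_congr rfl fun p _ => Finset.prod_congr rfl fun i _ => ?_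
  rw [mul_div_right_comm]

namespace IsLFamily

theorem exists_norm_localParam_le (hL : IsLFamily L α) :
    ∃ r : ℝ, 0 ≤ r ∧ r < 1 ∧ ∀ σ : ℝ, 1 / 2 ≤ σ → ∀ j p i, ‖localParam α σ j p i‖ ≤ r := by
  obtain ⟨θ, _, hθ, hα⟩ := hL.param_bound
  refine ⟨2 ^ (θ - 1 / 2), by positivity,
    Real.rpow_lt_one_of_one_lt_of_neg one_lt_two (by linarith), fun σ hσ j p i => ?_⟩
  have hp2 : (2 : ℝ) ≤ p := by exact_mod_cast p.2.two_le
  have hp0 : (0 : ℝ) < p := by linarith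
  rw [norm_localParam]
  calc ‖α j i p‖ / (p : ℝ) ^ σ ≤ (p : ℝ) ^ θ / (p : ℝ) ^ σ := by gcongr; exact hα j i p
    _ = (p : ℝ) ^ (θ - σ) := (Real.rpow_sub hp0 _ _).symm
    _ ≤ (p : ℝ) ^ (θ - 1 / 2) := Real.rpow_le_rpow_of_exponent_le (by linarith) (by linarith)
    _ ≤ 2 ^ (θ - 1 / 2) := Real.rpow_le_rpow_of_nonpos two_pos hp2 (by linarith)

theorem exists_sum_norm_localParam_pow_four_le (hL : IsLFamily L α) (j : Fin J) :
    ∃ B : ℝ, ∀ σ : ℝ, 1 / 2 ≤ σ → ∀ s : Finset Nat.Primes,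
      ∑ p ∈ s, ∑ i, ‖localParam α σ j p i‖ ^ 4 ≤ B := by
  obtain ⟨θ, hθ0, hθ, hα⟩ := hL.param_bound
  have hε : 0 < (1 - 2 * θ) / 2 := by linarith
  obtain ⟨B, hB⟩ := exists_sum_mul_rpow_neg_le (h := fun p => ∑ i, ‖α j i p‖ ^ 2)
    (fun p => Finset.sum_nonneg fun i _ => by positivity) hε (hL.ramanujan_average j _ hε)
  refine ⟨B, fun σ hσ s => le_trans (Finset.sum_le_sum fun p _ => ?_) (hB s)⟩
  have hp1 : (1 : ℝ) ≤ p := by exact_mod_cast p.2.one_lt.le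
  have hp0 : (0 : ℝ) < p := by linarith
  rw [Finset.sum_mul]
  refine Finset.sum_le_sum fun i _ => ?_
  rw [norm_localParam, div_pow]
  have h1 : ‖α j i p‖ ^ 4 ≤ ‖α j i p‖ ^ 2 * (p : ℝ) ^ (2 * θ) := by
    have : (p : ℝ) ^ (2 * θ) = ((p : ℝ) ^ θ) ^ 2 := by
      rw [← Real.rpow_natCast, ← Real.rpow_mul hp0.le]; congr 1; push_cast; ring
    rw [this, show (4 : ℕ) = 2 + 2 from rfl, pow_add]
    gcongr
    exact hα j i p
  have h2 : (p : ℝ) ^ (2 : ℝ) ≤ ((p : ℝ) ^ σ) ^ 4 := by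
    rw [← Real.rpow_natCast, ← Real.rpow_mul hp0.le]
    exact Real.rpow_le_rpow_of_exponent_le hp1 (by push_cast; linarith)
  calc ‖α j i p‖ ^ 4 / ((p : ℝ) ^ σ) ^ 4
      ≤ (‖α j i p‖ ^ 2 * (p : ℝ) ^ (2 * θ)) / (p : ℝ) ^ (2 : ℝ) := by gcongr
    _ = ‖α j i p‖ ^ 2 * (p : ℝ) ^ (-(1 + 2 * ((1 - 2 * θ) / 2))) := by
        rw [mul_div_assoc, ← Real.rpow_sub hp0]; congr 2; ring

theorem exists_sum_norm_sq_eulerLogCoeff_div_le (hL : IsLFamily L α) (j : Fin J) :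
    ∃ C x₀ : ℝ, Real.exp (Real.exp 1) ≤ x₀ ∧ ∀ x : ℝ, x₀ ≤ x →
      ∑ p ∈ primesUpTo ⌊x⌋₊, ‖eulerLogCoeff α j p 1‖ ^ 2 / (p : ℝ)
        ≤ C * Real.log (Real.log x) := by
  obtain ⟨ξ, c, hξ, hO⟩ := hL.orthonormality
  obtain ⟨C, hC⟩ := (hO j j).bound
  obtain ⟨x₀, hx₀⟩ := eventually_atTop.1 hC
  refine ⟨ξ j + ‖c j j‖ + |C|, max x₀ (Real.exp (Real.exp 1)), le_max_right _ _, fun x hx => ?_⟩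
  have hlog : Real.exp 1 ≤ Real.log x :=
    (Real.le_log_iff_exp_le ((Real.exp_pos _).trans_le ((le_max_right _ _).trans hx))).2
      ((le_max_right _ _).trans hx)
  have hlog0 : 0 < Real.log x := (Real.exp_pos _).trans_le hlog
  have hlog1 : 1 ≤ Real.log x := (Real.one_le_exp zero_le_one).trans hlog
  have hll : 1 ≤ Real.log (Real.log x) := (Real.le_log_iff_exp_le hlog0).2 hlog
  have h := hx₀ x ((le_max_left _ _).trans hx)
  set S := ∑ p ∈ primesUpTo ⌊x⌋₊, ‖eulerLogCoeff α j p 1‖ ^ 2 / (p : ℝ) with hS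
  have hcast : ∑ p ∈ primesUpTo ⌊x⌋₊,
      eulerLogCoeff α j p 1 * conj (eulerLogCoeff α j p 1) / (p : ℂ) = (S : ℂ) := by
    rw [hS]; push_cast
    exact Finset.sum_congr rfl fun p _ => by rw [Complex.mul_conj']
  rw [hcast, if_pos rfl, Real.norm_of_nonneg (by positivity)] at h
  have h1 : |S - ξ j * Real.log (Real.log x)| ≤ |C| + ‖c j j‖ := by
    rw [← Real.norm_eq_abs, ← Complex.norm_real]
    push_cast
    calc ‖(S : ℂ) - ξ j * (Real.log (Real.log x) : ℝ)‖
        = ‖((S : ℂ) - ((ξ j * Real.log (Real.log x) : ℝ) : ℂ) - c j j) + c j j‖ := by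
          push_cast; ring_nf
      _ ≤ |C| + ‖c j j‖ := by
          refine (norm_add_le _ _).trans (add_le_add (h.trans ?_) le_rfl)
          calc C * (1 / Real.log x) ≤ |C| * 1 := by
                refine mul_le_mul (le_abs_self C) ?_ (by positivity) (abs_nonneg C)
                rw [div_le_one hlog0]; exact hlog1
            _ = |C| := mul_one _
  have h2 := (abs_le.1 h1).2
  nlinarith [abs_nonneg C, norm_nonneg (c j j)]

/-- The total variance of the logarithms of the random Euler products is `≪ log log T` for
`σ = 1/2 + 1/G`, `2 < G ≤ log T`. -/
theorem exists_sum_logEulerFactorVar_le (hL : IsLFamily L α) (r : ℝ) :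
    ∃ A T₀ : ℝ, 0 < A ∧ Real.exp (Real.exp 1) ≤ T₀ ∧ ∀ T G : ℝ, T₀ ≤ T → 2 < G →
      G ≤ Real.log T → ∀ (j : Fin J) (s : Finset Nat.Primes),
        ∑ p ∈ s, logEulerFactorVar r (localParam α (1 / 2 + 1 / G) j p)
          ≤ A * Real.log (Real.log T) := by
  have h1 : ∀ j : Fin J, ∃ B x₀ : ℝ, Real.exp (Real.exp 1) ≤ x₀ ∧ ∀ T G : ℝ, x₀ ≤ T → 0 < G →
      G ≤ Real.log T → ∀ s : Finset Nat.Primes,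
        ∑ p ∈ s, ‖eulerLogCoeff α j p 1‖ ^ 2 / (p : ℝ) * (p : ℝ) ^ (-(2 / G))
          ≤ B * Real.log (Real.log T) := by
    intro j
    obtain ⟨C, x₀, hx₀, h⟩ := hL.exists_sum_norm_sq_eulerLogCoeff_div_le j
    obtain ⟨B, hB⟩ := exists_sum_mul_rpow_neg_le_log_log (fun p => by positivity) hx₀ h
    exact ⟨B, x₀, hx₀, hB⟩
  choose B₁ x₀ hx₀ h1 using h1
  choose B₂ h2 using hL.exists_sum_norm_localParam_pow_four_le
  set K : ℝ := (1 - r)⁻¹ ^ 2 * d with hK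
  have hK0 : 0 ≤ K := by positivity
  refine ⟨∑ j, (2 * |B₁ j| + 2 * (K * |B₂ j|)) + 1, Real.exp (Real.exp 1) + ∑ j, |x₀ j|,
    by positivity, le_add_of_nonneg_right (by positivity), fun T G hT hG hGT j s => ?_⟩
  have hTj : x₀ j ≤ T := by
    have := Finset.single_le_sum (f := fun j => |x₀ j|) (fun _ _ => abs_nonneg _)
      (Finset.mem_univ j)
    have := le_abs_self (x₀ j)
    have := Real.exp_pos (Real.exp 1)
    linarith
  have hT0 : Real.exp (Real.exp 1) ≤ T := (hx₀ j).trans hTj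
  have hlog : Real.exp 1 ≤ Real.log T :=
    (Real.le_log_iff_exp_le ((Real.exp_pos _).trans_le hT0)).2 hT0
  have hll : 1 ≤ Real.log (Real.log T) :=
    (Real.le_log_iff_exp_le ((Real.exp_pos _).trans_le hlog)).2 hlog
  have hG0 : 0 < G := by linarith
  have hσ : 1 / 2 ≤ 1 / 2 + 1 / G := by
    have : 0 < 1 / G := by positivity
    linarith
  have e1 : ∀ p : Nat.Primes, ‖∑ i, localParam α (1 / 2 + 1 / G) j p i‖ ^ 2
      = ‖eulerLogCoeff α j p 1‖ ^ 2 / (p : ℝ) * (p : ℝ) ^ (-(2 / G)) := by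
    intro p
    have hp0 : (0 : ℝ) < p := by exact_mod_cast p.2.pos
    rw [sum_localParam, norm_div, Complex.norm_real, Real.norm_of_nonneg (by positivity), div_pow]
    have : ((p : ℝ) ^ (1 / 2 + 1 / G)) ^ 2 = (p : ℝ) * (p : ℝ) ^ (2 / G) := by
      rw [← Real.rpow_natCast, ← Real.rpow_mul hp0.le]
      have : (1 / 2 + 1 / G) * ((2 : ℕ) : ℝ) = 1 + 2 / G := by push_cast; ring
      rw [this, Real.rpow_add hp0, Real.rpow_one]
    rw [this, Real.rpow_neg hp0.le]
    field_simp
  have hsum : ∑ p ∈ s, logEulerFactorVar r (localParam α (1 / 2 + 1 / G) j p)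
      = 2 * ∑ p ∈ s, ‖eulerLogCoeff α j p 1‖ ^ 2 / (p : ℝ) * (p : ℝ) ^ (-(2 / G))
        + 2 * (K * ∑ p ∈ s, ∑ i, ‖localParam α (1 / 2 + 1 / G) j p i‖ ^ 4) := by
    simp only [logEulerFactorVar, e1, Finset.sum_add_distrib, Finset.mul_sum, hK, mul_assoc]
  have e2 := h1 j T G hTj hG0 hGT s
  have e3 := h2 j _ hσ s
  have e4 : 2 * |B₁ j| + 2 * (K * |B₂ j|) ≤ ∑ j, (2 * |B₁ j| + 2 * (K * |B₂ j|)) :=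
    Finset.single_le_sum (f := fun j => 2 * |B₁ j| + 2 * (K * |B₂ j|))
      (fun _ _ => by positivity) (Finset.mem_univ j)
  rw [hsum]
  calc _ ≤ 2 * (|B₁ j| * Real.log (Real.log T)) + 2 * (K * (|B₂ j| * Real.log (Real.log T))) := by
        gcongr
        · exact e2.trans (mul_le_mul_of_nonneg_right (le_abs_self _) (by linarith))
        · exact e3.trans ((le_abs_self _).trans (le_mul_of_one_le_right (abs_nonneg _) hll))
    _ = (2 * |B₁ j| + 2 * (K * |B₂ j|)) * Real.log (Real.log T) := by ring
    _ ≤ _ := mul_le_mul_of_nonneg_right (by linarith) (by linarith)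

/-- By orthonormality, two members of the family have different coefficients at infinitely many
primes. -/
theorem infinite_eulerLogCoeff_ne (hL : IsLFamily L α) {j k : Fin J} (hjk : j ≠ k) :
    {p : Nat.Primes | eulerLogCoeff α j p 1 ≠ eulerLogCoeff α k p 1}.Infinite := by
  intro hfin
  obtain ⟨ξ, c, hξ, hO⟩ := hL.orthonormality
  set S := hfin.toFinset
  set N := S.sup fun p => (p : ℕ)
  set g : Nat.Primes → ℂ := fun p => eulerLogCoeff α k p 1 * conj (eulerLogCoeff α k p 1) / (p : ℂ)
    - eulerLogCoeff α k p 1 * conj (eulerLogCoeff α j p 1) / (p : ℂ) with hg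
  have hO1 : (fun x : ℝ => 1 / Real.log x) =O[atTop] fun _ : ℝ => (1 : ℝ) := by
    have : Tendsto (fun x : ℝ => 1 / Real.log x) atTop (𝓝 0) := by
      simp only [one_div]
      exact Real.tendsto_log_atTop.inv_tendsto_atTop
    exact this.isBigO_one ℝ
  have hdiff := ((hO k k).sub (hO k j)).trans hO1
  obtain ⟨C, hC⟩ := hdiff.bound
  have hconst : ∀ x : ℝ, (N : ℝ) ≤ x → ∑ p ∈ primesUpTo ⌊x⌋₊, g p = ∑ p ∈ S, g p := by
    intro x hx
    symm
    refine Finset.sum_subset (fun p hp => ?_) fun p _ hp => ?_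
    · exact mem_primesUpTo.2 ((Finset.le_sup (f := fun p : Nat.Primes => (p : ℕ)) hp).trans
        (Nat.le_floor hx))
    · have : eulerLogCoeff α j p 1 = eulerLogCoeff α k p 1 := by
        by_contra h
        exact hp (hfin.mem_toFinset.2 h)
      simp only [hg, this, sub_self]
  have htend : Tendsto (fun x : ℝ => ξ k * Real.log (Real.log x)) atTop atTop :=
    (Real.tendsto_log_atTop.comp Real.tendsto_log_atTop).const_mul_atTop (hξ k)
  set E : ℂ := ∑ p ∈ S, g p
  obtain ⟨x, ⟨hx1, hx2⟩, hx3⟩ := ((hC.and (eventually_ge_atTop (N : ℝ))).and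
    (htend.eventually_gt_atTop (C + ‖E - c k k + c k j‖))).exists
  have hE := hconst x hx2
  simp only [hg, Finset.sum_sub_distrib] at hE
  simp only [if_true, if_neg hjk.symm, norm_one, mul_one, Complex.ofReal_zero, sub_zero] at hx1
  have heq : ((ξ k * Real.log (Real.log x) : ℝ) : ℂ) = (E - c k k + c k j)
      - ((∑ p ∈ primesUpTo ⌊x⌋₊,
          eulerLogCoeff α k p 1 * conj (eulerLogCoeff α k p 1) / (p : ℂ)
        - ((ξ k * Real.log (Real.log x) : ℝ) : ℂ) - c k k)
        - (∑ p ∈ primesUpTo ⌊x⌋₊,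
          eulerLogCoeff α k p 1 * conj (eulerLogCoeff α j p 1) / (p : ℂ) - c k j)) := by
    rw [← hE]; ring
  have hle := (norm_sub_le (E - c k k + c k j) _).trans (add_le_add le_rfl hx1)
  rw [← heq, Complex.norm_real] at hle
  have := Real.le_norm_self (ξ k * Real.log (Real.log x))
  linarith

/-- Distinct primes separating the members of the family from a given one. -/
theorem exists_injective_eulerLogCoeff_ne (hL : IsLFamily L α) (j₀ : Fin J) :
    ∃ f : Fin J → Nat.Primes, Function.Injective f ∧
      ∀ j, j ≠ j₀ → eulerLogCoeff α j (f j) 1 ≠ eulerLogCoeff α j₀ (f j) 1 := by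
  classical
  have h : ∀ j, ∃ t : Finset Nat.Primes, J ≤ t.card ∧
      ∀ p ∈ t, j ≠ j₀ → eulerLogCoeff α j p 1 ≠ eulerLogCoeff α j₀ p 1 := by
    intro j
    by_cases hj : j = j₀
    · obtain ⟨t, ht⟩ := Infinite.exists_subset_card_eq Nat.Primes J
      exact ⟨t, ht.ge, fun _ _ hne => absurd hj hne⟩
    · obtain ⟨t, hts, ht⟩ := (hL.infinite_eulerLogCoeff_ne hj).exists_subset_card_eq J
      exact ⟨t, ht.ge, fun p hp _ => hts hp⟩
  choose t htcard ht using h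
  obtain ⟨f, hf, hft⟩ := (Finset.all_card_le_biUnion_card_iff_exists_injective t).1 fun s => by
    rcases s.eq_empty_or_nonempty with rfl | ⟨j, hj⟩
    · simp
    · calc s.card ≤ J := by simpa using s.card_le_univ
        _ ≤ (t j).card := htcard j
        _ ≤ _ := Finset.card_le_card (Finset.subset_biUnion_of_mem t hj)
  exact ⟨f, hf, fun j hj => ht j _ (hft j) hj⟩

end IsLFamily

end Family

/-! ### Convergence of sums over primes in increasing order -/

/-- The primes in increasing order. -/
def nthPrime (n : ℕ) : Nat.Primes := ⟨Nat.nth Nat.Prime n, Nat.prime_nth_prime n⟩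

theorem nthPrime_injective : Function.Injective nthPrime := fun _ _ h =>
  Nat.nth_injective Nat.infinite_setOfPred_prime (congrArg Subtype.val h)

theorem primesUpTo_eq_map (N : ℕ) :
    primesUpTo N = (Finset.range (Nat.primeCounting N)).map ⟨nthPrime, nthPrime_injective⟩ := by
  ext p
  simp only [mem_primesUpTo, Finset.mem_map, Finset.mem_range, Function.Embedding.coeFn_mk]
  constructor
  · intro hp
    exact ⟨Nat.count Nat.Prime p, Nat.count_strict_mono p.2 (Nat.lt_succ_of_le hp),
      Subtype.ext (Nat.nth_count p.2)⟩
  · rintro ⟨n, hn, rfl⟩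
    exact Nat.lt_succ_iff.1 (Nat.nth_lt_of_lt_count hn)

theorem tendsto_sum_primesUpTo {y : Nat.Primes → ℝ} {l : ℝ}
    (h : Tendsto (fun n => ∑ i ∈ Finset.range n, y (nthPrime i)) atTop (𝓝 l)) :
    Tendsto (fun N => ∑ p ∈ primesUpTo N, y p) atTop (𝓝 l) := by
  refine (h.comp Nat.tendsto_primeCounting).congr fun N => ?_
  simp [primesUpTo_eq_map]

/-! ### The random Euler products -/

section Random

variable {Ω : Type*} [MeasurableSpace Ω] {P : Measure Ω}
  {X : Nat.Primes → Ω → ℂ} {J d : ℕ} {α : Fin J → Fin d → Nat.Primes → ℂ} {r σ : ℝ}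

theorem measurable_randomLPartial (α : Fin J → Fin d → Nat.Primes → ℂ) (σ : ℝ)
    (hX : ∀ p, Measurable (X p)) (j : Fin J) (N : ℕ) :
    Measurable fun x => randomLPartial α σ (fun p => X p x) j N := by
  simp only [randomLPartial_eq_prod_eulerFactor]
  exact Finset.measurable_fun_prod _ fun p _ => (measurable_eulerFactor _).comp (hX p)

theorem randomLPartial_eq_exp (hr : r < 1) (hγ : ∀ j p i, ‖localParam α σ j p i‖ ≤ r)
    {x : Nat.Primes → ℂ} (hx : ∀ p, ‖x p‖ = 1) (j : Fin J) (N : ℕ) :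
    randomLPartial α σ x j N =
      Complex.exp (∑ p ∈ primesUpTo N, logEulerFactor (localParam α σ j p) (x p)) := by
  rw [randomLPartial_eq_prod_eulerFactor, Complex.exp_sum]
  exact Finset.prod_congr rfl fun p _ =>
    (exp_logEulerFactor (fun i => (hγ j p i).trans_lt hr) (hx p)).symm

theorem integral_logEulerFactor_comp (hX : ∀ p, Measurable (X p))
    (hlaw : ∀ p, P.map (X p) = uniformUnitCircle) (hr : r < 1)
    (hγ : ∀ j p i, ‖localParam α σ j p i‖ ≤ r) (j : Fin J) (p : Nat.Primes) :
    ∫ x, logEulerFactor (localParam α σ j p) (X p x) ∂P = 0 := by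
  rw [← integral_map (hX p).aemeasurable (measurable_logEulerFactor _).aestronglyMeasurable,
    hlaw p, integral_logEulerFactor fun i => (hγ j p i).trans_lt hr]

variable [IsProbabilityMeasure P]

theorem integrable_logEulerFactor_comp (hX : ∀ p, Measurable (X p))
    (hX1 : ∀ p x, ‖X p x‖ = 1) (hr : r < 1)
    (hγ : ∀ j p i, ‖localParam α σ j p i‖ ≤ r) (j : Fin J) (p : Nat.Primes) :
    Integrable (fun x => logEulerFactor (localParam α σ j p) (X p x)) P :=
  Integrable.of_bound ((measurable_logEulerFactor _).comp (hX p)).aestronglyMeasurable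
    (d * (1 + (1 - r)⁻¹)) (Eventually.of_forall fun x =>
      norm_logEulerFactor_le hr (hγ j p) (hX1 p x))

/-- Exponential moments of `log |L_j|`, uniformly in the truncation. -/
theorem lintegral_randomLPartial_rpow_le (hind : iIndepFun X P) (hX : ∀ p, Measurable (X p))
    (hlaw : ∀ p, P.map (X p) = uniformUnitCircle) (hX1 : ∀ p x, ‖X p x‖ = 1) (hr : r < 1)
    (hγ : ∀ j p i, ‖localParam α σ j p i‖ ≤ r) (j : Fin J) {V : ℝ}
    (hV : ∀ s : Finset Nat.Primes, ∑ p ∈ s, logEulerFactorVar r (localParam α σ j p) ≤ V)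
    {t : ℝ} (ht : |t| * (d * (1 + (1 - r)⁻¹)) ≤ 1) (N : ℕ) :
    ∫⁻ x, ‖randomLPartial α σ (fun p => X p x) j N‖ₑ ^ t ∂P
      ≤ ENNReal.ofReal (Real.exp (t ^ 2 * V)) := by
  set Y : Nat.Primes → Ω → ℝ := fun p x => (logEulerFactor (localParam α σ j p) (X p x)).re
  have hYm : ∀ p, Measurable (Y p) := fun p =>
    Complex.measurable_re.comp ((measurable_logEulerFactor _).comp (hX p))
  have hYM : ∀ p x, |Y p x| ≤ d * (1 + (1 - r)⁻¹) := fun p x =>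
    (Complex.abs_re_le_norm _).trans (norm_logEulerFactor_le hr (hγ j p) (hX1 p x))
  have hYmean : ∀ p, ∫ x, Y p x ∂P = 0 := fun p => by
    have h := integral_re (integrable_logEulerFactor_comp (P := P) hX hX1 hr hγ j p)
    rw [integral_logEulerFactor_comp hX hlaw hr hγ j p] at h
    simpa using h
  have hYv : ∀ p x, Y p x ^ 2 ≤ logEulerFactorVar r (localParam α σ j p) := fun p x =>
    (sq_le_sq.2 (by rw [abs_norm]; exact Complex.abs_re_le_norm _)).trans
      (norm_sq_logEulerFactor_le hr (hγ j p) (hX1 p x))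
  have hYind : iIndepFun Y P :=
    hind.comp (fun p z => (logEulerFactor (localParam α σ j p) z).re)
      fun p => Complex.measurable_re.comp (measurable_logEulerFactor _)
  have hmgf := mgf_sum_le_exp_sq_mul hYind hYm hYM hYmean hYv ht (primesUpTo N) (hV _)
  have hint := integrable_exp_mul_sum (P := P) hYm hYM (primesUpTo N) t
  calc ∫⁻ x, ‖randomLPartial α σ (fun p => X p x) j N‖ₑ ^ t ∂P
      = ∫⁻ x, ENNReal.ofReal (Real.exp (t * (∑ p ∈ primesUpTo N, Y p) x)) ∂P := by
        refine lintegral_congr fun x => ?_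
        rw [randomLPartial_eq_exp hr hγ (fun p => hX1 p x), ← ofReal_norm, Complex.norm_exp,
          ENNReal.ofReal_rpow_of_pos (Real.exp_pos _), ← Real.exp_mul, Complex.re_sum,
          Finset.sum_apply, mul_comm]
    _ = ENNReal.ofReal (mgf (∑ p ∈ primesUpTo N, Y p) P t) :=
        (ofReal_integral_eq_lintegral_ofReal hint
          (Eventually.of_forall fun x => (Real.exp_pos _).le)).symm
    _ ≤ _ := ENNReal.ofReal_le_ofReal hmgf

theorem ae_exists_tendsto_randomLPartial (hind : iIndepFun X P) (hX : ∀ p, Measurable (X p))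
    (hlaw : ∀ p, P.map (X p) = uniformUnitCircle) (hX1 : ∀ p x, ‖X p x‖ = 1) (hr : r < 1)
    (hγ : ∀ j p i, ‖localParam α σ j p i‖ ≤ r) (j : Fin J) {V : ℝ}
    (hV : ∀ s : Finset Nat.Primes, ∑ p ∈ s, logEulerFactorVar r (localParam α σ j p) ≤ V) :
    ∀ᵐ x ∂P, ∃ l : ℂ, l ≠ 0 ∧
      Tendsto (randomLPartial α σ (fun p => X p x) j) atTop (𝓝 l) := by
  have hV' : ∀ s : Finset ℕ,
      ∑ i ∈ s, logEulerFactorVar r (localParam α σ j (nthPrime i)) ≤ V := fun s => by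
    simpa using hV (s.map ⟨nthPrime, nthPrime_injective⟩)
  have hmeas : ∀ i, Measurable fun x =>
      logEulerFactor (localParam α σ j (nthPrime i)) (X (nthPrime i) x) := fun i =>
    (measurable_logEulerFactor _).comp (hX _)
  -- real and imaginary part are treated alike
  have key : ∀ u : ℂ → ℝ, Measurable u → (∀ z, |u z| ≤ ‖z‖) →
      (∀ p, ∫ x, u (logEulerFactor (localParam α σ j p) (X p x)) ∂P = 0) →
      ∀ᵐ x ∂P, ∃ l : ℝ, Tendsto (fun N => ∑ p ∈ primesUpTo N,
        u (logEulerFactor (localParam α σ j p) (X p x))) atTop (𝓝 l) := by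
    intro u hu hule hmean
    have hconv := ae_exists_tendsto_sum_range (P := P)
      (Y := fun i x => u (logEulerFactor (localParam α σ j (nthPrime i)) (X (nthPrime i) x)))
      (M := d * (1 + (1 - r)⁻¹))
      (v := fun i => logEulerFactorVar r (localParam α σ j (nthPrime i)))
      ((hind.precomp nthPrime_injective).comp
        (fun i z => u (logEulerFactor (localParam α σ j (nthPrime i)) z))
        fun i => hu.comp (measurable_logEulerFactor _))
      (fun i => hu.comp (hmeas i))
      (fun i x => (hule _).trans (norm_logEulerFactor_le hr (hγ j _) (hX1 _ x)))
      (fun i => hmean _)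
      (fun i x => (sq_le_sq.2 (by rw [abs_norm]; exact hule _)).trans
        (norm_sq_logEulerFactor_le hr (hγ j _) (hX1 _ x))) hV'
    filter_upwards [hconv] with x ⟨l, hl⟩
    exact ⟨l, tendsto_sum_primesUpTo
      (y := fun p => u (logEulerFactor (localParam α σ j p) (X p x))) hl⟩
  have hre := key Complex.re Complex.measurable_re Complex.abs_re_le_norm fun p => by
    have h := integral_re (integrable_logEulerFactor_comp (P := P) hX hX1 hr hγ j p)
    rw [integral_logEulerFactor_comp hX hlaw hr hγ j p] at h
    simpa using h
  have him := key Complex.im Complex.measurable_im Complex.abs_im_le_norm fun p => by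
    have h := integral_im (integrable_logEulerFactor_comp (P := P) hX hX1 hr hγ j p)
    rw [integral_logEulerFactor_comp hX hlaw hr hγ j p] at h
    simpa using h
  filter_upwards [hre, him] with x ⟨a, ha⟩ ⟨b, hb⟩
  refine ⟨Complex.exp (a + b * Complex.I), Complex.exp_ne_zero _, ?_⟩
  have h1 : Tendsto (fun N => ((∑ p ∈ primesUpTo N,
      (logEulerFactor (localParam α σ j p) (X p x)).re : ℝ) : ℂ)
      + ((∑ p ∈ primesUpTo N, (logEulerFactor (localParam α σ j p) (X p x)).im : ℝ) : ℂ)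
        * Complex.I) atTop (𝓝 (a + b * Complex.I)) :=
    ((Complex.continuous_ofReal.tendsto a).comp ha).add
      (((Complex.continuous_ofReal.tendsto b).comp hb).mul_const _)
  refine ((Complex.continuous_exp.tendsto _).comp h1).congr fun N => ?_
  rw [randomLPartial_eq_exp hr hγ fun p => hX1 p x, Function.comp, ← Complex.re_sum,
    ← Complex.im_sum, Complex.re_add_im]

end Random

/-! ### Negative moments of the normalised linear combination -/

/-- The truncations of `F / L_{j₀}` have a bounded negative moment, uniformly in the truncation and
in `σ ∈ [1/2, 1]`: the terms of index `j ≠ j₀` are eliminated at one prime each. -/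
theorem IsLFamily.exists_lintegral_randomLPartial_ratio_rpow_neg_le {J d : ℕ}
    {L : Fin J → ℂ → ℂ} {α : Fin J → Fin d → Nat.Primes → ℂ} (hL : IsLFamily L α)
    {b : Fin J → ℝ} {j₀ : Fin J} (hb : b j₀ ≠ 0) :
    ∃ (δ : ℝ) (C : ℝ≥0∞) (N₀ : ℕ), 0 < δ ∧ C ≠ ∞ ∧
      ∀ (Ω : Type*) [MeasurableSpace Ω] (P : Measure Ω) [IsProbabilityMeasure P]
        (X : Nat.Primes → Ω → ℂ), iIndepFun X P → (∀ p, Measurable (X p)) →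
        (∀ p, P.map (X p) = uniformUnitCircle) → (∀ p x, ‖X p x‖ = 1) →
        ∀ σ : ℝ, 1 / 2 ≤ σ → σ ≤ 1 → ∀ N : ℕ, N₀ ≤ N →
          ∫⁻ x, ‖(∑ j, (b j : ℂ) * randomLPartial α σ (fun p => X p x) j N)
              / randomLPartial α σ (fun p => X p x) j₀ N‖ₑ ^ (-δ) ∂P ≤ C := by
  classical
  obtain ⟨r, hr0, hr1, hγ⟩ := hL.exists_norm_localParam_le
  obtain ⟨f, hfinj, hf⟩ := hL.exists_injective_eulerLogCoeff_ne j₀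
  set δ : ℝ := (2 * ((J * d : ℕ) + 1 : ℝ))⁻¹ with hδdef
  have hδ : 0 < δ := by positivity
  have hJd : (J * d : ℕ) * δ ≤ 1 / 2 := by
    rw [hδdef, ← div_eq_mul_inv, div_le_iff₀ (by positivity)]
    linarith
  obtain ⟨C, hC, -, hone⟩ := exists_lintegral_sum_eulerFactor_rpow_neg_le J d hδ hJd
  set S : Finset Nat.Primes := (Finset.univ.erase j₀).image f with hS
  -- at the prime `f m` the `m`-th term is eliminated
  set m : Nat.Primes → Fin J := Function.extend f id fun _ => j₀ with hm
  have hmf : ∀ j, m (f j) = j := fun j => hfinj.extend_apply _ _ j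
  set lam : ℝ → Fin J → Nat.Primes → ℂ := fun σ j p =>
    ∑ i, localParam α σ j p i - ∑ i, localParam α σ (m p) p i with hlam
  set c : ℝ := |b j₀| * ∏ p ∈ S,
    ‖eulerLogCoeff α j₀ p 1 - eulerLogCoeff α (m p) p 1‖ / (p : ℝ) with hc
  have hcpos : 0 < c := by
    refine mul_pos (abs_pos.2 hb) (Finset.prod_pos fun p hp => ?_)
    obtain ⟨j, hj, rfl⟩ := Finset.mem_image.1 hp
    have := hf j (Finset.ne_of_mem_erase hj)
    rw [hmf]
    exact div_pos (norm_pos_iff.2 (sub_ne_zero.2 this.symm))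
      (by exact_mod_cast (f j).2.pos)
  have hcne : ENNReal.ofReal c ^ (-δ) ≠ ∞ := by
    rw [ENNReal.ofReal_rpow_of_pos hcpos]; exact ENNReal.ofReal_ne_top
  refine ⟨δ, C ^ S.card * ENNReal.ofReal c ^ (-δ), S.sup fun p => (p : ℕ), hδ,
    ENNReal.mul_ne_top (ENNReal.pow_ne_top hC) hcne, ?_⟩
  intro Ω _ P _ X hind hX hlaw hX1 σ hσ hσ1 N hN
  have hlt : ∀ j p i, ‖localParam α σ j p i‖ < 1 := fun j p i => (hγ σ hσ j p i).trans_lt hr1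
  have hST : S ⊆ primesUpTo N := fun p hp =>
    mem_primesUpTo.2 ((Finset.le_sup (f := fun p : Nat.Primes => (p : ℕ)) hp).trans hN)
  set w : Fin J → Nat.Primes → ℂ → ℂ := fun j p z =>
    eulerFactor (localParam α σ j p) z / eulerFactor (localParam α σ j₀ p) z with hw
  have hwm : ∀ j p, Measurable (w j p) := fun j p => by simp only [hw]; fun_prop
  have helim := lintegral_sum_prod_rpow_neg_le_ite hind hX hlaw (δ := δ) (C := C) hwm
    (fun j => (b j : ℂ)) (lam σ) S hST fun p _ a =>
      hone (fun j => localParam α σ j p) (fun j i => hlt j p i) j₀ (m p) a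
  calc ∫⁻ x, ‖(∑ j, (b j : ℂ) * randomLPartial α σ (fun p => X p x) j N)
              / randomLPartial α σ (fun p => X p x) j₀ N‖ₑ ^ (-δ) ∂P
      = ∫⁻ x, ‖∑ j, (b j : ℂ) * ∏ p ∈ primesUpTo N, w j p (X p x)‖ₑ ^ (-δ) ∂P := by
        refine lintegral_congr fun x => ?_
        congr 2
        rw [Finset.sum_div]
        refine Finset.sum_congr rfl fun j _ => ?_
        rw [randomLPartial_eq_prod_eulerFactor, randomLPartial_eq_prod_eulerFactor,
          mul_div_assoc, Finset.prod_div_distrib]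
    _ ≤ C ^ S.card * ∫⁻ x, ‖∑ j, (b j : ℂ) * ∏ p ∈ primesUpTo N,
          (if p ∈ S then lam σ j p else w j p (X p x))‖ₑ ^ (-δ) ∂P := helim
    _ ≤ C ^ S.card * ∫⁻ _x, ENNReal.ofReal c ^ (-δ) ∂P := by
        refine mul_le_mul' le_rfl (lintegral_mono fun x => ?_)
        refine ennreal_rpow_neg_le_rpow_neg hδ.le ?_
        rw [← ofReal_norm]
        refine ENNReal.ofReal_le_ofReal ?_
        -- all terms but the one of index `j₀` contain a vanishing factor
        have hsingle : ∑ j, (b j : ℂ) * ∏ p ∈ primesUpTo N,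
            (if p ∈ S then lam σ j p else w j p (X p x)) = b j₀ * ∏ p ∈ S, lam σ j₀ p := by
          rw [Finset.sum_eq_single_of_mem j₀ (Finset.mem_univ _)]
          · congr 1
            rw [← Finset.prod_subset hST fun p _ hp => ?_]
            · exact Finset.prod_congr rfl fun p hp => if_pos hp
            · rw [if_neg hp, hw]
              exact div_self (eulerFactor_ne_zero (hlt j₀ p) (hX1 p x))
          · intro j _ hj
            have hjS : f j ∈ S :=
              Finset.mem_image_of_mem f (Finset.mem_erase.2 ⟨hj, Finset.mem_univ j⟩)
            rw [Finset.prod_eq_zero (hST hjS), mul_zero]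
            rw [if_pos hjS]
            simp only [hlam, hmf, sub_self]
        rw [hsingle, norm_mul, Complex.norm_real, Real.norm_eq_abs, norm_prod, hc]
        refine mul_le_mul_of_nonneg_left ?_ (abs_nonneg _)
        refine Finset.prod_le_prod (fun p _ => by positivity) fun p _ => ?_
        have hp1 : (1 : ℝ) ≤ p := by exact_mod_cast p.2.one_lt.le
        simp only [hlam, sum_localParam]
        rw [← sub_div, norm_div, Complex.norm_real, Real.norm_of_nonneg (by positivity)]
        refine div_le_div_of_nonneg_left (norm_nonneg _) (by positivity) ?_
        calc (p : ℝ) ^ σ ≤ (p : ℝ) ^ (1 : ℝ) := Real.rpow_le_rpow_of_exponent_le hp1 hσ1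
          _ = p := Real.rpow_one _
    _ = _ := by rw [lintegral_const, measure_univ, mul_one]

/-! ### Exponential moments of `log |F|` -/

theorem ennreal_rpow_sum_le_sum_rpow {ι : Type*} (s : Finset ι) (y : ι → ℝ≥0∞) {t : ℝ}
    (ht : 0 < t) (ht1 : t ≤ 1) : (∑ i ∈ s, y i) ^ t ≤ ∑ i ∈ s, y i ^ t := by
  classical
  induction s using Finset.induction_on with
  | empty => simp [ENNReal.zero_rpow_of_pos ht]
  | insert a s ha ih =>
    rw [Finset.sum_insert ha, Finset.sum_insert ha]
    exact (ENNReal.rpow_add_le_add_rpow _ _ ht.le ht1).trans (add_le_add le_rfl ih)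

theorem ennreal_rpow_neg_le_one_add {x : ℝ≥0∞} {s δ : ℝ} (hs : 0 ≤ s) (hsδ : s ≤ δ) :
    x ^ (-s) ≤ 1 + x ^ (-δ) := by
  rcases le_total x 1 with h | h
  · exact (ENNReal.rpow_le_rpow_of_exponent_ge h (neg_le_neg hsδ)).trans le_add_self
  · refine le_trans ?_ le_self_add
    simpa using ennreal_rpow_neg_le_rpow_neg hs h

/-- A negative power of a product is controlled by the squares of the factors' powers. -/
theorem ennreal_mul_rpow_neg_le {x y : ℝ≥0∞} (hx : x ≠ ∞) (hy : y ≠ ∞) (t : ℝ) :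
    (x * y) ^ (-t) ≤ x ^ (-(2 * t)) + y ^ (-(2 * t)) := by
  have hsq : ∀ a : ℝ≥0∞, a ^ (-(2 * t)) = a ^ (-t) * a ^ (-t) := fun a => by
    rw [← sq, ← ENNReal.rpow_natCast, ← ENNReal.rpow_mul]; congr 1; push_cast; ring
  rw [ENNReal.mul_rpow_of_ne_top hx hy, hsq, hsq]
  rcases le_total (x ^ (-t)) (y ^ (-t)) with h | h
  · exact (mul_le_mul' h le_rfl).trans le_add_self
  · exact (mul_le_mul' le_rfl h).trans le_self_add

/-- Exponential moments of both signs of `log |F|`, for `σ = 1/2 + 1/G` with `2 < G ≤ log T`, with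
the almost sure convergence that identifies `F` as the limit of its truncations. -/
theorem IsLFamily.exists_lintegral_randomF_rpow_le {J d : ℕ} {L : Fin J → ℂ → ℂ}
    {α : Fin J → Fin d → Nat.Primes → ℂ} (hL : IsLFamily L α) {b : Fin J → ℝ} (j₀ : Fin J)
    (hb : b j₀ ≠ 0) (hb1 : ∀ j, |b j| ≤ 1) :
    ∃ A K t₀ T₀ : ℝ, 0 < A ∧ 0 < K ∧ 0 < t₀ ∧ Real.exp (Real.exp 1) ≤ T₀ ∧
      ∀ (Ω : Type*) [MeasurableSpace Ω] (P : Measure Ω) [IsProbabilityMeasure P]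
        (X : Nat.Primes → Ω → ℂ), iIndepFun X P → (∀ p, Measurable (X p)) →
        (∀ p, P.map (X p) = uniformUnitCircle) → (∀ p x, ‖X p x‖ = 1) →
        ∀ T G : ℝ, T₀ ≤ T → 2 < G → G ≤ Real.log T →
          (∀ᵐ x ∂P, ∀ j, ∃ l : ℂ, l ≠ 0 ∧
            Tendsto (randomLPartial α (1 / 2 + 1 / G) (fun p => X p x) j) atTop (𝓝 l)) ∧
          AEMeasurable (fun x => randomF b α (1 / 2 + 1 / G) (fun p => X p x)) P ∧
          ∀ t : ℝ, 0 < t → t ≤ t₀ →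
            ∫⁻ x, (‖randomF b α (1 / 2 + 1 / G) (fun p => X p x)‖ₑ ^ t
                + ‖randomF b α (1 / 2 + 1 / G) (fun p => X p x)‖ₑ ^ (-t)) ∂P
              ≤ ENNReal.ofReal
                  (K * Real.exp ((2 * t) ^ 2 * (A * Real.log (Real.log T)))) := by
  obtain ⟨r, hr0, hr1, hγ⟩ := hL.exists_norm_localParam_le
  obtain ⟨A, T₀, hA, hT₀, hvar⟩ := hL.exists_sum_logEulerFactorVar_le r
  obtain ⟨δ, C, N₀, hδ, hC, hneg⟩ := hL.exists_lintegral_randomLPartial_ratio_rpow_neg_le hb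
  set M : ℝ := d * (1 + (1 - r)⁻¹) with hM
  have hr' : 0 ≤ (1 - r)⁻¹ := inv_nonneg.2 (by linarith)
  have hM0 : 0 ≤ M := by positivity
  set t₀ : ℝ := min (min 1 (δ / 2)) (2 * (M + 1))⁻¹ with ht₀
  refine ⟨A, J + 2 + C.toReal, t₀, T₀, hA, by positivity, by positivity, hT₀, ?_⟩
  intro Ω _ P _ X hind hX hlaw hX1 T G hT hG hGT
  set σ : ℝ := 1 / 2 + 1 / G with hσ
  have hG0 : 0 < G := by linarith
  have hσ2 : 1 / 2 ≤ σ := by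
    have : 0 < 1 / G := by positivity
    linarith
  have hσ1 : σ ≤ 1 := by
    have : 1 / G ≤ 1 / 2 := one_div_le_one_div_of_le two_pos hG.le
    linarith
  have hγσ := hγ σ hσ2
  set V : ℝ := A * Real.log (Real.log T) with hVdef
  have hV := hvar T G hT hG hGT
  have hLP : ∀ j N, Measurable fun x => randomLPartial α σ (fun p => X p x) j N :=
    fun j N => measurable_randomLPartial α σ hX j N
  have hconv : ∀ᵐ x ∂P, ∀ j, ∃ l : ℂ, l ≠ 0 ∧
      Tendsto (randomLPartial α σ (fun p => X p x) j) atTop (𝓝 l) :=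
    ae_all_iff.2 fun j => ae_exists_tendsto_randomLPartial hind hX hlaw hX1 hr1 hγσ j (hV j)
  set F : ℕ → Ω → ℂ := fun N x => ∑ j, (b j : ℂ) * randomLPartial α σ (fun p => X p x) j N
    with hF
  have hFm : ∀ N, Measurable (F N) := fun N => by
    refine Finset.measurable_fun_sum _ fun j _ => ?_
    exact measurable_const.mul (hLP j N)
  have hFlim : ∀ᵐ x ∂P, Tendsto (fun N => F N x) atTop (𝓝 (randomF b α σ fun p => X p x)) := by
    filter_upwards [hconv] with x hx
    refine tendsto_finsetSum _ fun j _ => Tendsto.const_mul _ ?_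
    obtain ⟨l, _, hl⟩ := hx j
    exact tendsto_nhds_limUnder ⟨l, hl⟩
  refine ⟨hconv, aemeasurable_of_tendsto_metrizable_ae atTop (fun N => (hFm N).aemeasurable) hFlim,
    fun t ht htt₀ => ?_⟩
  have ht1 : t ≤ 1 := htt₀.trans ((min_le_left _ _).trans (min_le_left _ _))
  have htδ : 2 * t ≤ δ := by
    have : t ≤ δ / 2 := htt₀.trans ((min_le_left _ _).trans (min_le_right _ _))
    linarith
  have htM : 2 * t * M ≤ 1 := by
    have h1 : t ≤ (2 * (M + 1))⁻¹ := htt₀.trans (min_le_right _ _)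
    rw [← one_div, le_div_iff₀ (by positivity)] at h1
    nlinarith
  have hV0 : 0 ≤ V := by
    refine le_trans ?_ (hV j₀ ∅)
    simp
  set E : ℝ := Real.exp ((2 * t) ^ 2 * V) with hE
  have hE1 : 1 ≤ E := Real.one_le_exp (by positivity)
  have hLne : ∀ N x, randomLPartial α σ (fun p => X p x) j₀ N ≠ 0 := fun N x => by
    rw [randomLPartial_eq_exp hr1 hγσ fun p => hX1 p x]; exact Complex.exp_ne_zero _
  have hpos : ∀ N, ∫⁻ x, ‖F N x‖ₑ ^ t ∂P ≤ ENNReal.ofReal (J * E) := by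
    intro N
    calc ∫⁻ x, ‖F N x‖ₑ ^ t ∂P
        ≤ ∫⁻ x, ∑ j, ‖randomLPartial α σ (fun p => X p x) j N‖ₑ ^ t ∂P := by
          refine lintegral_mono fun x => ?_
          refine le_trans ?_ (ennreal_rpow_sum_le_sum_rpow _ _ ht ht1)
          refine ENNReal.rpow_le_rpow ?_ ht.le
          refine (enorm_sum_le _ _).trans (Finset.sum_le_sum fun j _ => ?_)
          rw [enorm_mul]
          refine mul_le_of_le_one_left zero_le ?_
          rw [← ofReal_norm, Complex.norm_real, ENNReal.ofReal_le_one]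
          exact hb1 j
      _ = ∑ j, ∫⁻ x, ‖randomLPartial α σ (fun p => X p x) j N‖ₑ ^ t ∂P :=
          lintegral_finsetSum _ fun j _ => (hLP j N).enorm.pow_const _
      _ ≤ ∑ _j : Fin J, ENNReal.ofReal E := by
          refine Finset.sum_le_sum fun j _ => ?_
          refine (lintegral_randomLPartial_rpow_le hind hX hlaw hX1 hr1 hγσ j (hV j) ?_ N).trans ?_
          · rw [abs_of_pos ht]; nlinarith
          · refine ENNReal.ofReal_le_ofReal (Real.exp_le_exp.2 ?_)
            exact mul_le_mul_of_nonneg_right (by nlinarith) hV0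
      _ = ENNReal.ofReal (J * E) := by
          rw [ENNReal.ofReal_mul (by positivity)]; simp
  -- `F = L_{j₀} * (F / L_{j₀})`, and the two factors are treated separately
  have hnegF : ∀ N, N₀ ≤ N → ∫⁻ x, ‖F N x‖ₑ ^ (-t) ∂P ≤ ENNReal.ofReal (E + (1 + C.toReal)) := by
    intro N hN
    set R : Ω → ℂ := fun x => F N x / randomLPartial α σ (fun p => X p x) j₀ N with hR
    have hRm : Measurable R := (hFm N).div (hLP j₀ N)
    have h1 : ∫⁻ x, ‖randomLPartial α σ (fun p => X p x) j₀ N‖ₑ ^ (-(2 * t)) ∂P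
        ≤ ENNReal.ofReal E := by
      have := lintegral_randomLPartial_rpow_le hind hX hlaw hX1 hr1 hγσ j₀ (hV j₀)
        (t := -(2 * t)) (by rwa [abs_neg, abs_of_pos (by positivity)]) N
      rwa [neg_sq] at this
    have h2 : ∫⁻ x, ‖R x‖ₑ ^ (-(2 * t)) ∂P ≤ 1 + C := by
      calc ∫⁻ x, ‖R x‖ₑ ^ (-(2 * t)) ∂P ≤ ∫⁻ x, (1 + ‖R x‖ₑ ^ (-δ)) ∂P :=
            lintegral_mono fun x => ennreal_rpow_neg_le_one_add (by positivity) htδ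
        _ = 1 + ∫⁻ x, ‖R x‖ₑ ^ (-δ) ∂P := by
            rw [lintegral_add_left measurable_const, lintegral_const, measure_univ, one_mul]
        _ ≤ 1 + C := add_le_add le_rfl (hneg Ω P X hind hX hlaw hX1 σ hσ2 hσ1 N hN)
    calc ∫⁻ x, ‖F N x‖ₑ ^ (-t) ∂P
        ≤ ∫⁻ x, (‖randomLPartial α σ (fun p => X p x) j₀ N‖ₑ ^ (-(2 * t))
            + ‖R x‖ₑ ^ (-(2 * t))) ∂P := by
          refine lintegral_mono fun x => ?_
          have : F N x = randomLPartial α σ (fun p => X p x) j₀ N * R x :=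
            (mul_div_cancel₀ _ (hLne N x)).symm
          rw [this, enorm_mul]
          exact ennreal_mul_rpow_neg_le enorm_ne_top enorm_ne_top t
      _ = ∫⁻ x, ‖randomLPartial α σ (fun p => X p x) j₀ N‖ₑ ^ (-(2 * t)) ∂P
            + ∫⁻ x, ‖R x‖ₑ ^ (-(2 * t)) ∂P :=
          lintegral_add_left ((hLP j₀ N).enorm.pow_const _) _
      _ ≤ ENNReal.ofReal E + (1 + C) := add_le_add h1 h2
      _ = _ := by
          rw [ENNReal.ofReal_add (by positivity) (by positivity),
            ENNReal.ofReal_add one_pos.le (by positivity), ENNReal.ofReal_one,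
            ENNReal.ofReal_toReal hC]
  set Φ : ℕ → Ω → ℝ≥0∞ := fun N x => ‖F N x‖ₑ ^ t + ‖F N x‖ₑ ^ (-t) with hΦ
  have hΦm : ∀ N, Measurable (Φ N) := fun N =>
    ((hFm N).enorm.pow_const _).add ((hFm N).enorm.pow_const _)
  have hΦle : ∀ N, N₀ ≤ N → ∫⁻ x, Φ N x ∂P ≤ ENNReal.ofReal ((J + 2 + C.toReal) * E) := by
    intro N hN
    simp only [hΦ]
    rw [lintegral_add_left ((hFm N).enorm.pow_const _)]
    refine (add_le_add (hpos N) (hnegF N hN)).trans ?_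
    rw [← ENNReal.ofReal_add (by positivity) (by positivity)]
    refine ENNReal.ofReal_le_ofReal ?_
    nlinarith [mul_le_mul_of_nonneg_left hE1 (ENNReal.toReal_nonneg (a := C))]
  have hΦlim : ∀ᵐ x ∂P, Tendsto (fun N => Φ N x) atTop
      (𝓝 (‖randomF b α σ fun p => X p x‖ₑ ^ t + ‖randomF b α σ fun p => X p x‖ₑ ^ (-t))) := by
    filter_upwards [hFlim] with x hx
    exact ((ENNReal.continuous_rpow_const.tendsto _).comp hx.enorm).add
      ((ENNReal.continuous_rpow_const.tendsto _).comp hx.enorm)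
  calc ∫⁻ x, (‖randomF b α σ fun p => X p x‖ₑ ^ t + ‖randomF b α σ fun p => X p x‖ₑ ^ (-t)) ∂P
      = ∫⁻ x, liminf (fun N => Φ N x) atTop ∂P :=
        lintegral_congr_ae (hΦlim.mono fun x hx => hx.liminf_eq.symm)
    _ ≤ liminf (fun N => ∫⁻ x, Φ N x ∂P) atTop := lintegral_liminf_le hΦm
    _ ≤ _ := liminf_le_of_frequently_le'
        ((eventually_ge_atTop N₀).mono fun N hN => hΦle N hN).frequently

/-! ### From exponential moments to moments -/

/-- Moments of `log ‖f‖` from the exponential moments `‖f‖ ^ t + ‖f‖ ^ (-t)`, by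
`y ^ (2k) ≤ (2k)! e ^ y`. -/
theorem ofReal_abs_log_pow_le {z : ℂ} (hz : z ≠ 0) {t : ℝ} (ht : 0 < t) (k : ℕ) :
    ENNReal.ofReal (|Real.log ‖z‖| ^ (2 * k)) ≤
      ENNReal.ofReal ((2 * k).factorial / t ^ (2 * k)) * (‖z‖ₑ ^ t + ‖z‖ₑ ^ (-t)) := by
  have hz0 : 0 < ‖z‖ := norm_pos_iff.2 hz
  rw [← ofReal_norm, ENNReal.ofReal_rpow_of_pos hz0, ENNReal.ofReal_rpow_of_pos hz0,
    ← ENNReal.ofReal_add (by positivity) (by positivity), ← ENNReal.ofReal_mul (by positivity)]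
  refine ENNReal.ofReal_le_ofReal ?_
  have h1 := Real.pow_div_factorial_le_exp (x := t * |Real.log ‖z‖|) (by positivity) (2 * k)
  have h2 : Real.exp (t * |Real.log ‖z‖|) ≤ ‖z‖ ^ t + ‖z‖ ^ (-t) := by
    rw [Real.rpow_def_of_pos hz0, Real.rpow_def_of_pos hz0]
    have e1 := Real.exp_pos (Real.log ‖z‖ * t)
    have e2 := Real.exp_pos (Real.log ‖z‖ * -t)
    rcases abs_cases (Real.log ‖z‖) with ⟨h, _⟩ | ⟨h, _⟩ <;> rw [h]
    · rw [mul_comm t]; linarith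
    · rw [show t * -Real.log ‖z‖ = Real.log ‖z‖ * -t by ring]; linarith
  rw [div_le_iff₀ (by positivity), mul_pow] at h1
  rw [div_mul_eq_mul_div, le_div_iff₀ (by positivity)]
  nlinarith [mul_le_mul_of_nonneg_right h2 (Nat.cast_nonneg (α := ℝ) (2 * k).factorial)]

/-- The choice `t ^ 2 = t₀ ^ 2 * k / (k + ℓ)` of the exponent. -/
theorem factorial_div_pow_mul_exp_le {t₀ A ℓ : ℝ} (ht₀ : 0 < t₀) (hA : 0 ≤ A) (hℓ : 0 ≤ ℓ) {k : ℕ}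
    (hk : 1 ≤ k) {t : ℝ} (ht : t ^ 2 = t₀ ^ 2 * (k / (k + ℓ))) :
    (2 * k).factorial / t ^ (2 * k) * Real.exp ((2 * t) ^ 2 * (A * ℓ)) ≤
      (4 * Real.exp (4 * t₀ ^ 2 * A) / t₀ ^ 2 * k * (k + ℓ)) ^ k := by
  have hk0 : (0 : ℝ) < k := by exact_mod_cast hk
  have hkl : 0 < k + ℓ := by positivity
  have h1 : ((2 * k).factorial : ℝ) ≤ (4 * (k : ℝ) ^ 2) ^ k := by
    calc ((2 * k).factorial : ℝ) ≤ ((2 * k : ℕ) : ℝ) ^ (2 * k) := by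
          exact_mod_cast Nat.factorial_le_pow (2 * k)
      _ = _ := by rw [pow_mul]; push_cast; ring
  have h2 : Real.exp ((2 * t) ^ 2 * (A * ℓ)) ≤ Real.exp (4 * t₀ ^ 2 * A) ^ k := by
    rw [← Real.exp_nat_mul]
    refine Real.exp_le_exp.2 ?_
    have : (2 * t) ^ 2 * (A * ℓ) = k * (4 * t₀ ^ 2 * A) * (ℓ / (k + ℓ)) := by
      rw [mul_pow, ht]; ring
    rw [this]
    refine mul_le_of_le_one_right (by positivity) ?_
    rw [div_le_one hkl]; linarith
  rw [pow_mul t, ht]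
  calc _ ≤ (4 * (k : ℝ) ^ 2) ^ k / (t₀ ^ 2 * (k / (k + ℓ))) ^ k
        * Real.exp (4 * t₀ ^ 2 * A) ^ k := by gcongr
    _ = _ := by
        rw [← div_pow, ← mul_pow]
        congr 1
        field_simp

/-- Independent variables with the uniform law on the circle agree almost surely with measurable
ones that take values on the circle. -/
theorem exists_measurable_norm_eq_one_ae_eq {Ω : Type*} [MeasurableSpace Ω] {P : Measure Ω}
    {X : Nat.Primes → Ω → ℂ} (hlaw : ∀ p, HasLaw (X p) uniformUnitCircle P) :
    ∃ Y : Nat.Primes → Ω → ℂ, (∀ p, Measurable (Y p)) ∧ (∀ p x, ‖Y p x‖ = 1) ∧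
      ∀ p, X p =ᵐ[P] Y p := by
  classical
  have hs : ∀ p, MeasurableSet {x | ‖(hlaw p).aemeasurable.mk _ x‖ = 1} := fun p =>
    measurableSet_eq_fun (hlaw p).aemeasurable.measurable_mk.norm measurable_const
  refine ⟨fun p x => if ‖(hlaw p).aemeasurable.mk _ x‖ = 1 then (hlaw p).aemeasurable.mk _ x else 1,
    fun p => Measurable.ite (hs p) (hlaw p).aemeasurable.measurable_mk measurable_const,
    fun p x => ?_, fun p => ?_⟩
  · dsimp only
    split_ifs with h
    exacts [h, norm_one]
  · have h1 : ∀ᵐ x ∂P, ‖X p x‖ = 1 := by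
      have := ae_norm_eq_one_uniformUnitCircle
      rw [← (hlaw p).map_eq] at this
      exact ae_of_ae_map (hlaw p).aemeasurable this
    filter_upwards [h1, (hlaw p).aemeasurable.ae_eq_mk] with x hx hx'
    rw [if_pos (hx' ▸ hx), hx']

end

theorem proposition2p5 {J d : ℕ} (hJ : 2 ≤ J) (L : Fin J → ℂ → ℂ)
    (α : Fin J → Fin d → Nat.Primes → ℂ) (hL : IsLFamily L α)
    (b : Fin J → ℝ) (hb : ∀ j, b j ≠ 0) (hb_sq : ∑ j, b j ^ 2 = 1) :
    ∃ C₃ A T₀ : ℝ, 0 < C₃ ∧ 0 < A ∧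
      ∀ (Ω : Type*) [MeasurableSpace Ω] (P : Measure Ω) [IsProbabilityMeasure P]
        (X : Nat.Primes → Ω → ℂ), iIndepFun X P → (∀ p, HasLaw (X p) uniformUnitCircle P) →
      ∀ T G : ℝ, T₀ ≤ T → 2 < G → G ≤ Real.log T →
        -- the random Euler products converge almost surely, and `F(σ, X) ≠ 0` almost surely
        (∀ᵐ w ∂P,
          (∀ j, ∃ l : ℂ, l ≠ 0 ∧
            Tendsto (randomLPartial α (1 / 2 + 1 / G) (fun p => X p w) j) atTop (𝓝 l)) ∧
          randomF b α (1 / 2 + 1 / G) (fun p => X p w) ≠ 0) ∧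
        ∀ k : ℕ, 1 ≤ k →
          Integrable
            (fun w => |Real.log ‖randomF b α (1 / 2 + 1 / G) (fun p => X p w)‖| ^ (2 * k)) P ∧
          ∫ w, |Real.log ‖randomF b α (1 / 2 + 1 / G) (fun p => X p w)‖| ^ (2 * k) ∂P ≤
            A * Real.log (Real.log T) ^ J *
              (C₃ * k * (k + Real.log (Real.log T))) ^ k := by
  have hb1 : ∀ j, |b j| ≤ 1 := fun j => by
    rw [← sq_le_one_iff_abs_le_one, ← hb_sq]
    exact Finset.single_le_sum (f := fun j => b j ^ 2) (fun _ _ => sq_nonneg _)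
      (Finset.mem_univ j)
  obtain ⟨A, K, t₀, T₀, hA, hK, ht₀, hT₀, hmain⟩ :=
    hL.exists_lintegral_randomF_rpow_le (⟨0, by omega⟩ : Fin J) (hb _) hb1
  refine ⟨4 * Real.exp (4 * t₀ ^ 2 * A) / t₀ ^ 2, K, T₀, by positivity, hK, ?_⟩
  intro Ω _ P _ X hind hlaw T G hT hG hGT
  obtain ⟨Y, hYm, hY1, hXY⟩ := exists_measurable_norm_eq_one_ae_eq hlaw
  have hYlaw : ∀ p, P.map (Y p) = uniformUnitCircle := fun p => by
    rw [← Measure.map_congr (hXY p), (hlaw p).map_eq]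
  have hXYall : ∀ᵐ x ∂P, (fun p => X p x) = fun p => Y p x := by
    filter_upwards [ae_all_iff.2 hXY] with x hx
    exact funext hx
  obtain ⟨hconv, hFm, hmom⟩ :=
    hmain Ω P Y ((iIndepFun_congr hXY).1 hind) hYm hYlaw hY1 T G hT hG hGT
  set f : Ω → ℂ := fun x => randomF b α (1 / 2 + 1 / G) fun p => Y p x with hf
  have hfX : ∀ᵐ x ∂P, randomF b α (1 / 2 + 1 / G) (fun p => X p x) = f x := by
    filter_upwards [hXYall] with x hx
    rw [hx]
  have hne : ∀ᵐ x ∂P, f x ≠ 0 := by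
    have hfin := ne_top_of_le_ne_top ENNReal.ofReal_ne_top (hmom t₀ ht₀ le_rfl)
    have hm : AEMeasurable (fun x => ‖f x‖ₑ ^ t₀ + ‖f x‖ₑ ^ (-t₀)) P :=
      (hFm.enorm.pow_const _).add (hFm.enorm.pow_const _)
    filter_upwards [ae_lt_top' hm hfin] with x hx h0
    simp [h0, ENNReal.zero_rpow_of_neg (neg_lt_zero.2 ht₀)] at hx
  refine ⟨?_, fun k hk => ?_⟩
  · filter_upwards [hXYall, hconv, hne] with x hx hc h0
    rw [hx]
    exact ⟨hc, h0⟩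
  have hT1 : Real.exp (Real.exp 1) ≤ T := hT₀.trans hT
  have hlog : Real.exp 1 ≤ Real.log T :=
    (Real.le_log_iff_exp_le ((Real.exp_pos _).trans_le hT1)).2 hT1
  have hℓ : 1 ≤ Real.log (Real.log T) :=
    (Real.le_log_iff_exp_le ((Real.exp_pos _).trans_le hlog)).2 hlog
  set ℓ := Real.log (Real.log T) with hℓdef
  have hk0 : (0 : ℝ) < k := by exact_mod_cast hk
  have hq1 : (k : ℝ) / (k + ℓ) ≤ 1 := by rw [div_le_one (by positivity)]; linarith
  set t : ℝ := t₀ * √(k / (k + ℓ)) with ht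
  have htpos : 0 < t := by positivity
  have htt₀ : t ≤ t₀ := mul_le_of_le_one_right ht₀.le (Real.sqrt_le_one.2 hq1)
  have htsq : t ^ 2 = t₀ ^ 2 * (k / (k + ℓ)) := by
    rw [ht, mul_pow, Real.sq_sqrt (by positivity)]
  set B : ℝ := K * (4 * Real.exp (4 * t₀ ^ 2 * A) / t₀ ^ 2 * k * (k + ℓ)) ^ k with hB
  have hlint : ∫⁻ x, ENNReal.ofReal (|Real.log ‖f x‖| ^ (2 * k)) ∂P ≤ ENNReal.ofReal B := by
    calc ∫⁻ x, ENNReal.ofReal (|Real.log ‖f x‖| ^ (2 * k)) ∂P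
        ≤ ∫⁻ x, ENNReal.ofReal ((2 * k).factorial / t ^ (2 * k))
            * (‖f x‖ₑ ^ t + ‖f x‖ₑ ^ (-t)) ∂P :=
          lintegral_mono_ae (hne.mono fun x hx => ofReal_abs_log_pow_le hx htpos k)
      _ = ENNReal.ofReal ((2 * k).factorial / t ^ (2 * k))
            * ∫⁻ x, (‖f x‖ₑ ^ t + ‖f x‖ₑ ^ (-t)) ∂P :=
          lintegral_const_mul' _ _ ENNReal.ofReal_ne_top
      _ ≤ ENNReal.ofReal ((2 * k).factorial / t ^ (2 * k))
            * ENNReal.ofReal (K * Real.exp ((2 * t) ^ 2 * (A * ℓ))) :=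
          mul_le_mul' le_rfl (hmom t htpos htt₀)
      _ ≤ ENNReal.ofReal B := by
          rw [← ENNReal.ofReal_mul (by positivity)]
          refine ENNReal.ofReal_le_ofReal ?_
          rw [hB, mul_left_comm]
          exact mul_le_mul_of_nonneg_left
            (factorial_div_pow_mul_exp_le ht₀ hA.le (by linarith) hk htsq) hK.le
  have hmeas : AEStronglyMeasurable (fun x => |Real.log ‖f x‖| ^ (2 * k)) P := by
    have : AEMeasurable (fun x => |Real.log ‖f x‖|) P :=
      (Real.measurable_log.comp_aemeasurable hFm.norm).abs
    exact (this.pow_const _).aestronglyMeasurable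
  have hint : Integrable (fun x => |Real.log ‖f x‖| ^ (2 * k)) P := by
    refine ⟨hmeas, ?_⟩
    rw [hasFiniteIntegral_iff_ofReal (Eventually.of_forall fun x => by positivity)]
    exact hlint.trans_lt ENNReal.ofReal_lt_top
  have hae : (fun x => |Real.log ‖randomF b α (1 / 2 + 1 / G) (fun p => X p x)‖| ^ (2 * k))
      =ᵐ[P] fun x => |Real.log ‖f x‖| ^ (2 * k) := hfX.mono fun x hx => by
    simp only [hx]
  refine ⟨hint.congr hae.symm, ?_⟩
  rw [integral_congr_ae hae, integral_eq_lintegral_of_nonneg_ae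
    (Eventually.of_forall fun x => by positivity) hmeas]
  refine (ENNReal.toReal_le_of_le_ofReal (by positivity) hlint).trans ?_
  rw [hB]
  refine mul_le_mul_of_nonneg_right ?_ (by positivity)
  exact le_mul_of_one_le_right hK.le (one_le_pow₀ hℓ)
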